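/- **Setting (the set theory AS of approximations).** Put $V_0=\{\emptyset\}$ and $V_{n+1}=\mathcal P(V_n)$, so that $V_n$ is the finite set of hereditarily finite sets of rank at most $n$. Let $F(0,a)=\emptyset$ and $F(n+1,a)=\{F(n,x)\mid x\in a\}$. An *AS-set* $A$ is a sequence $(F(n,A))_{n\in\mathbb N}$ with $F(n,A)\in V_n$ and $F(n,F(n+1,A))=F(n,A)$ for all $n$; for AS-sets $x,A$ one puts $x\in A$ iff $F(n,x)\in F(n+1,A)$ for every $n$. For every property $P$ of AS-sets there is a smallest AS-set containing all $x$ with $P(x)$. From here on "set" means AS-set. Pairs $\{a,b\}$, $(a,b)=\{\{a\},\{a,b\}\}$, $A\times B$, $A\cup B$ are as usual, and $B\setminus A$ is the smallest set containing all $x\in B$ with $x\notin A$. A finite N-ordinal $n$ is a finite von Neumann ordinal, and $A_1+A_2=(\{1\}\times A_1)\cup(\{2\}\times A_2)$. Relations, functions, injections and bijections are themselves sets (of ordered pairs). *Cardinality.* $A\le_c B$ means that there is an injection from $A$ into $B$; $A=_cB$ means $A\le_cB$ and $B\le_cA$; $A<_cB$ means $A\le_cB$ and not $A=_cB$. A set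 is infinite if it is in bijection with a proper subset of itself. *Topology.* The basic neighbourhoods of $x$ are $\{y\mid F(n,y)=F(n,x)\}$, $n\in\mathbb N$. A point $x$ is an accumulation point in $A$ if each of them contains some $y\in A$, $y\ne x$; $A'$ is the set of all accumulation points in $A$. *Well-orderings.* A set $R\subseteq A\times A$ *well-orders* $A$ if, writing $x<y$ for "$x\neq y$ and $(x,y)\in R$", (a) $<$ is an asymmetric, transitive and total relation on $A$; (b) every nonempty subset of $A$ has a $<$-minimal element; (c) every $x\in A$ has a basic neighbourhood containing no $y\in A$ with $x<y$. A set is well-orderable if some $R$ well-orders it. An *ordinal* is a set with a well-ordering of it. $\alpha\le_o\beta$ (resp. $\alpha<_o\beta$) means that there is an order-preserving bijection from $\alpha$ onto an (resp. a proper) initial segment of $\beta$; $\alpha=_o\beta$ means $\alpha\le_o\beta\le_o\alpha$. A nonempty ordinal $\alpha$ is a *successor* if $m=\max\alpha$ satisfies $m\notin\alpha\setminus\{m\}$; its predecessors are then the ordinals $p$ with $p=_o\alpha\setminus\{m\}$. Every other nonempty ordinal is a *limit*. *Cantor-Bendixson rank.* Put $A^{(\emptyset)}=A$, $A^{(\alpha)}=(A^{(p)})'$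 if $p$ is a predecessor of $\alpha$, and $A^{(\alpha)}=\bigcap_{\beta<_o\alpha}A^{(\beta)}$ if $\alpha$ is a limit. The rank $r_{CB}(A)$ of a well-orderable set $A$ is a $\le_o$-smallest ordinal $\alpha$ with $(A^{(\alpha)})'=\emptyset$ (determined up to $=_o$). **Theorem.** 1. If $A\ne\emptyset$ is well-orderable and $n$ is a finite N-ordinal, then $n\times A<_c(n+1)\times A$. 2. If $A_1$ and $A_2$ are infinite and well-orderable, then $A_1+A_2<_cA_1\times A_2$. 3. Let $A_1\le_cA_2$ be well-orderable. If $r_{CB}(A_1)<_or_{CB}(A_2)$, then $A_1+A_2=_cA_2$. If $A_1\neq\emptyset$ and $r_{CB}(A_1)=_or_{CB}(A_2)$, then $A_2<_cA_1+A_2$. -/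

import Mathlib

namespace AS

/-- `HF n` is the type of hereditarily finite sets of rank at most `n`: for `n = 0` the only one is
the empty set, and the hereditarily finite sets of rank at most `n + 1` are the sets of hereditarily
finite sets of rank at most `n`. All these types are finite, see the instance below. -/
def HF : ℕ → Type
  | 0 => Unit
  | n + 1 => Set (HF n)

instance HF.instFinite : (n : ℕ) → Finite (HF n)
  | 0 => inferInstanceAs (Finite Unit)
  | n + 1 =>
    haveI := HF.instFinite n
    inferInstanceAs (Finite (Set (HF n)))

/-- The `n`th approximation `F(n, A)` of a hereditarily finite set `A` of rank at most `n + 1`: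
`F(0, A) = {}` and `F(n + 1, A) = {F(n, x) | x ∈ A}`. -/
def HF.trunc : (n : ℕ) → HF (n + 1) → HF n
  | 0, _ => ()
  | n + 1, A => (HF.trunc n '' (show Set (HF (n + 1)) from A) : Set (HF n))

/-- The universe of the set theory of approximations: a set is an infinite path in the universal
tree, that is a sequence `F(0, A), F(1, A), F(2, A), …`, where `F(n, A)` is a hereditarily finite
set of rank at most `n` and `F(n, F(n + 1, A)) = F(n, A)`. -/
@[ext]
structure ASet : Type where
  /-- `A.approx n` is the `n`th approximation `F(n, A)`. -/
  approx : (n : ℕ) → HF n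
  coherent : ∀ n, HF.trunc n (approx (n + 1)) = approx n

/-- `{F(n, x) | x ∈ A}`, that is `F(n + 1, A)`, viewed as a set of hereditarily finite sets. -/
def ASet.level (A : ASet) (n : ℕ) : Set (HF n) := A.approx (n + 1)

/-- `x ∈ A` if and only if `F(n, x) ∈ F(n + 1, A)` for every `n`. -/
instance : Membership ASet ASet := ⟨fun A x => ∀ n, x.approx n ∈ A.level n⟩

instance : HasSubset ASet := ⟨fun A B => ∀ x : ASet, x ∈ A → x ∈ B⟩

/-- The approximations of the smallest set which contains all `x` with `P x`. -/
def hullApprox (P : ASet → Prop) : (n : ℕ) → HF n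
  | 0 => ()
  | n + 1 => ({a | ∃ x, P x ∧ x.approx n = a} : Set (HF n))

/-- The smallest set which contains all `x` with `P x`; its `(n + 1)`th approximation is
`{F(n, x) | P x}`. -/
def hull (P : ASet → Prop) : ASet where
  approx := hullApprox P
  coherent
    | 0 => rfl
    | n + 1 => by
      change HF.trunc n '' {a | ∃ x, P x ∧ x.approx (n + 1) = a} = {a | ∃ x, P x ∧ x.approx n = a}
      ext a
      constructor
      · rintro ⟨_, ⟨x, hx, rfl⟩, rfl⟩
        exact ⟨x, hx, (x.coherent n).symm⟩
      · rintro ⟨x, hx, rfl⟩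
        exact ⟨_, ⟨x, hx, rfl⟩, x.coherent n⟩

instance : EmptyCollection ASet := ⟨hull fun _ => False⟩

/-- `{a, b}` -/
def pair (a b : ASet) : ASet := hull fun x => x = a ∨ x = b

/-- `{a}` -/
def single (a : ASet) : ASet := pair a a

/-- The ordered pair `(a, b) = {{a}, {a, b}}`. -/
def opair (a b : ASet) : ASet := pair (single a) (pair a b)

/-- The cartesian product `A × B`. -/
def prod (A B : ASet) : ASet := hull fun z => ∃ a ∈ A, ∃ b ∈ B, z = opair a b

/-- `A ∪ B` -/
def union (A B : ASet) : ASet := hull fun x => x ∈ A ∨ x ∈ B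

/-- `A ∩ B` -/
def inter (A B : ASet) : ASet := hull fun x => x ∈ A ∧ x ∈ B

/-- The relative complement `B \ A`: the smallest set containing all elements of `B` that are not
elements of `A`. -/
def diff (B A : ASet) : ASet := hull fun x => x ∈ B ∧ x ∉ A

/-- The finite von Neumann ordinals: `0 = ∅` and `n + 1 = n ∪ {n}`. -/
def nOrd : ℕ → ASet
  | 0 => ∅
  | n + 1 => union (nOrd n) (single (nOrd n))

/-- The sum `A₁ + A₂ = {1} × A₁ ∪ {2} × A₂`. -/
def sum (A₁ A₂ : ASet) : ASet :=
  union (prod (single (nOrd 1)) A₁) (prod (single (nOrd 2)) A₂)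

/-! ### Functions and cardinality -/

/-- `f` is an injection from `A` into `B`: a relation between the elements of `A` and `B` (itself a
set of the universe) which is total, functional and injective. -/
structure IsInjection (f A B : ASet) : Prop where
  subset : f ⊆ prod A B
  total : ∀ a ∈ A, ∃ b ∈ B, opair a b ∈ f
  functional : ∀ a b b', opair a b ∈ f → opair a b' ∈ f → b = b'
  injective : ∀ a a' b, opair a b ∈ f → opair a' b ∈ f → a = a'

/-- `f` is a bijection from `A` to `B`. -/
structure IsBijection (f A B : ASet) : Prop extends IsInjection f A B where
  surjective : ∀ b ∈ B, ∃ a ∈ A, opair a b ∈ f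

/-- `A ≤_c B` -/
def CardLE (A B : ASet) : Prop := ∃ f, IsInjection f A B

/-- `A =_c B` -/
def CardEq (A B : ASet) : Prop := CardLE A B ∧ CardLE B A

/-- `A <_c B` -/
def CardLT (A B : ASet) : Prop := CardLE A B ∧ ¬ CardEq A B

/-- A set is infinite if it is in bijection with a proper subset of itself. -/
def IsInfinite (A : ASet) : Prop := ∃ B, B ⊆ A ∧ B ≠ A ∧ ∃ f, IsBijection f A B

/-! ### Well-orderings -/

/-- The strict relation `x < y` given by a relation `R`. As every set is topologically closed, a
linear ordering of a set with an accumulation point `x` exists as a set only if `(x, x)` is an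
element of it. Hence the pairs `(x, x)` are disregarded. -/
def Less (R x y : ASet) : Prop := x ≠ y ∧ opair x y ∈ R

/-- `R` is a linear ordering of `A`: an asymmetric, transitive and total relation on `A`. -/
structure IsLinearOrdering (R A : ASet) : Prop where
  subset : R ⊆ prod A A
  asymm : ∀ x ∈ A, ∀ y ∈ A, Less R x y → ¬ Less R y x
  trans : ∀ x ∈ A, ∀ y ∈ A, ∀ z ∈ A, Less R x y → Less R y z → Less R x z
  total : ∀ x ∈ A, ∀ y ∈ A, x ≠ y → Less R x y ∨ Less R y x

/-- `m` is the minimal element of `S` with regard to `R`. -/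
def IsMin (R S m : ASet) : Prop := m ∈ S ∧ ∀ x ∈ S, x ≠ m → Less R m x

/-- `m` is the maximal element of `S` with regard to `R`. -/
def IsMax (R S m : ASet) : Prop := m ∈ S ∧ ∀ x ∈ S, x ≠ m → Less R x m

/-- `y` lies in the `n`th basic neighbourhood `V(n, x) = {y | F(n, y) = F(n, x)}` of `x` in the
topology of approximations. -/
def InNhd (n : ℕ) (x y : ASet) : Prop := y.approx n = x.approx n

/-- `x` is upward isolated in `A` with regard to `R`: some neighbourhood of `x` contains no
`y ∈ A` with `x < y`. -/
def UpwardIsolated (R A x : ASet) : Prop := ∃ n, ∀ y ∈ A, InNhd n x y → ¬ Less R x y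

/-- `A` is well-ordered by `R`. -/
structure WellOrders (R A : ASet) : Prop extends IsLinearOrdering R A where
  exists_min : ∀ S, S ⊆ A → S ≠ ∅ → ∃ m, IsMin R S m
  upward_isolated : ∀ x ∈ A, UpwardIsolated R A x

def WellOrderable (A : ASet) : Prop := ∃ R, WellOrders R A

/-! ### Ordinals -/

/-- A set together with a relation. -/
structure RelSet : Type where
  carrier : ASet
  rel : ASet

/-- An ordinal is a set together with a well-ordering of it. -/
def IsOrdinal (α : RelSet) : Prop := WellOrders α.rel α.carrier

/-- The set `S` with the relation that it inherits from `α`. -/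
def RelSet.restrict (α : RelSet) (S : ASet) : RelSet := ⟨S, inter α.rel (prod S S)⟩

/-- An isomorphism is a bijection which preserves the ordering. -/
structure IsIso (f : ASet) (α β : RelSet) : Prop extends IsBijection f α.carrier β.carrier where
  map_less : ∀ x₁ x₂ y₁ y₂, opair x₁ y₁ ∈ f → opair x₂ y₂ ∈ f →
    Less α.rel x₁ x₂ → Less β.rel y₁ y₂

/-- `S` is an initial segment of `α`. -/
def IsInitialSegment (S : ASet) (α : RelSet) : Prop :=
  S ⊆ α.carrier ∧ ∀ x ∈ S, ∀ y ∈ α.carrier, Less α.rel y x → y ∈ S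

/-- `α ≤_o β`: `α` is isomorphic to an initial segment of `β`. -/
def OrdLE (α β : RelSet) : Prop :=
  ∃ S, IsInitialSegment S β ∧ ∃ f, IsIso f α (β.restrict S)

/-- `α =_o β` -/
def OrdEq (α β : RelSet) : Prop := OrdLE α β ∧ OrdLE β α

/-- `α <_o β`: `α` is isomorphic to a proper initial segment of `β`. -/
def OrdLT (α β : RelSet) : Prop :=
  ∃ S, IsInitialSegment S β ∧ S ≠ β.carrier ∧ ∃ f, IsIso f α (β.restrict S)

/-- The ordinal `p` is a predecessor of the ordinal `α`: it is isomorphic to `α \ {max α}`. Here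
`max α` has to be really removed: if `max α` is an accumulation point of `α`, then the set
`α \ {max α}` is `α` itself, and `α` has no predecessor. -/
def IsPredecessor (p α : RelSet) : Prop :=
  IsOrdinal p ∧ ∃ m, IsMax α.rel α.carrier m ∧ m ∉ diff α.carrier (single m) ∧
    OrdEq (α.restrict (diff α.carrier (single m))) p

/-- A limit ordinal is a nonempty ordinal which has no predecessor. -/
def IsLimitOrdinal (α : RelSet) : Prop :=
  IsOrdinal α ∧ α.carrier ≠ ∅ ∧ ¬ ∃ p, IsPredecessor p α

/-! ### Derived sets and Cantor-Bendixson rank -/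

/-- `x` is an accumulation point in `A`. -/
def IsAccPoint (A x : ASet) : Prop := ∀ n, ∃ y ∈ A, y ≠ x ∧ InNhd n x y

/-- The derived set `A'`, that is the set of all accumulation points in `A`. -/
def derived (A : ASet) : ASet := hull (IsAccPoint A)

/-- `IsIterDerived A α D` says that `D = A^(α)`, the iterated derived set of `A`, which is defined by
transfinite recursion on the ordinal `α`. -/
inductive IsIterDerived (A : ASet) : RelSet → ASet → Prop
  | zero (α : RelSet) (hα : IsOrdinal α) (h : α.carrier = ∅) : IsIterDerived A α A
  | succ (α p : RelSet) (D : ASet) (hα : IsOrdinal α) (hp : IsPredecessor p α)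
      (hD : IsIterDerived A p D) : IsIterDerived A α (derived D)
  | limit (α : RelSet) (D : RelSet → ASet) (hα : IsLimitOrdinal α)
      (hD : ∀ β, IsOrdinal β → OrdLT β α → IsIterDerived A β (D β)) :
      IsIterDerived A α (hull fun x => ∀ β, IsOrdinal β → OrdLT β α → x ∈ D β)

/-- `(A^(α))' = ∅` -/
def DerivedVanishesAfter (A : ASet) (α : RelSet) : Prop :=
  ∃ D, IsIterDerived A α D ∧ derived D = ∅

/-- `α` is a Cantor-Bendixson rank of `A`: a smallest ordinal with `(A^(α))' = ∅`. Any two such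
ordinals are isomorphic to each other. -/
structure IsCBRank (A : ASet) (α : RelSet) : Prop where
  isOrdinal : IsOrdinal α
  vanishes : DerivedVanishesAfter A α
  least : ∀ β, IsOrdinal β → DerivedVanishesAfter A β → OrdLE α β

end AS

/-! In the topology of approximations the universe is compact and metrizable, its sets are exactly
its closed subsets (`AS.mem_hull_iff`, `AS.isClosed_pts`, `AS.aset_ext`), and `A ≤_c B` means that a
continuous injection from `A` to `B` exists (`AS.cardLE_iff`). A well-orderable set is countable
(`AS.WellOrders.countable`), so if it is nonempty it has a last nonempty Cantor-Bendixson
derivative, which is finite (`exists_cbRank`, `AS.finite_cbDeriv`).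

All strict inequalities come from `mapsTo_cbDeriv`: a continuous injection maps `α`th derivatives
into `α`th derivatives. Hence the number of points of a finite `α`th derivative cannot decrease, and
this number is additive over disjoint unions. This settles `n × A` and the case of equal ranks. For
products, let `β` be the larger of the two ranks: the derivative of index `β + 1` is empty for the
sum but not for the product.

The equality for different ranks is an absorption argument (`AS.pointedAbsorption`): a closed set
whose `α`th derivative has at most one point fits into any neighbourhood of a point of an `α`th
derivative. A set of smaller rank can therefore be swallowed near one point of the last derivative
of `A₂`.

The internal ordinals have to be matched with Lean's. A nonempty one has a maximum, so order types
skip limits and the internal recursion does not run along them; `AS.RelSet.idx` counts the internal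
ordinals instead, and the internal `A^(α)` is the derivative with that index
(`AS.IsIterDerived.eq_iterDerived`). -/

open Set Filter Topology TopologicalSpace

/-! ### Cantor-Bendixson derivatives in topological spaces -/

section CantorBendixson

variable {X Y : Type*} [TopologicalSpace X] [TopologicalSpace Y]

/-- The `α`th Cantor-Bendixson derivative of `A`, relative to `A`. -/
def cbDeriv (A : Set X) (α : Ordinal.{0}) : Set X :=
  {x ∈ A | ∀ β, ∀ _ : β < α, x ∈ derivedSet (cbDeriv A β)}
termination_by α

theorem mem_cbDeriv {A : Set X} {α : Ordinal.{0}} {x : X} :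
    x ∈ cbDeriv A α ↔ x ∈ A ∧ ∀ β < α, x ∈ derivedSet (cbDeriv A β) := by
  rw [cbDeriv]; rfl

theorem cbDeriv_subset (A : Set X) (α : Ordinal.{0}) : cbDeriv A α ⊆ A :=
  fun _ hx => (mem_cbDeriv.1 hx).1

theorem cbDeriv_zero (A : Set X) : cbDeriv A 0 = A := by
  ext x
  simp [mem_cbDeriv]

theorem cbDeriv_antitone (A : Set X) : Antitone (cbDeriv A) := fun _ _ h _ hx =>
  mem_cbDeriv.2 ⟨(mem_cbDeriv.1 hx).1, fun γ hγ => (mem_cbDeriv.1 hx).2 γ (hγ.trans_le h)⟩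

theorem cbDeriv_subset_derivedSet (A : Set X) {α β : Ordinal.{0}} (h : α < β) :
    cbDeriv A β ⊆ derivedSet (cbDeriv A α) :=
  fun _ hx => (mem_cbDeriv.1 hx).2 _ h

theorem isClosed_cbDeriv [T1Space X] {A : Set X} (hA : IsClosed A) (α : Ordinal.{0}) :
    IsClosed (cbDeriv A α) := by
  have : cbDeriv A α = A ∩ ⋂ β, ⋂ _ : β < α, derivedSet (cbDeriv A β) := by
    ext x
    simp [mem_cbDeriv]
  rw [this]
  exact hA.inter (isClosed_iInter fun β => isClosed_iInter fun _ => isClosed_derivedSet _)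

theorem derivedSet_subset_of_isClosed {A B : Set X} (hA : IsClosed A) (h : B ⊆ A) :
    derivedSet B ⊆ A :=
  (derivedSet_mono _ _ h).trans ((isClosed_iff_derivedSet_subset A).1 hA)

theorem cbDeriv_add_one [T1Space X] {A : Set X} (hA : IsClosed A) (α : Ordinal.{0}) :
    cbDeriv A (α + 1) = derivedSet (cbDeriv A α) := by
  refine (cbDeriv_subset_derivedSet A (Order.lt_add_one_iff.2 le_rfl)).antisymm fun x hx => ?_
  refine mem_cbDeriv.2 ⟨derivedSet_subset_of_isClosed hA (cbDeriv_subset A α) hx, fun β hβ => ?_⟩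
  exact derivedSet_mono _ _ (cbDeriv_antitone A (Order.lt_add_one_iff.1 hβ)) hx

/-- Continuity carries points close to `x` to points close to `f x`, and injectivity keeps them
different from `f x`; so accumulation survives at every stage. Every upper bound on embeddings rests
on this. -/
theorem mapsTo_cbDeriv {A : Set X} {B : Set Y} {f : X → Y} (hf : ContinuousOn f A)
    (hinj : InjOn f A) (hm : MapsTo f A B) (α : Ordinal.{0}) :
    MapsTo f (cbDeriv A α) (cbDeriv B α) := by
  induction α using WellFoundedLT.induction with
  | ind α ih =>
    intro x hx
    have hxA := cbDeriv_subset A α hx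
    refine mem_cbDeriv.2 ⟨hm hxA, fun β hβ => ?_⟩
    have hacc := cbDeriv_subset_derivedSet A hβ hx
    rw [mem_derivedSet, accPt_iff_nhds] at hacc ⊢
    intro U hU
    obtain ⟨V, hV, hVU⟩ := mem_nhdsWithin_iff_exists_mem_nhds_inter.1 (hf x hxA hU)
    obtain ⟨y, ⟨hyV, hy⟩, hne⟩ := hacc V hV
    have hyA := cbDeriv_subset A β hy
    exact ⟨f y, ⟨hVU ⟨hyV, hyA⟩, ih β hβ hy⟩, fun h => hne (hinj hyA hxA h)⟩

theorem cbDeriv_mono {A B : Set X} (h : A ⊆ B) (α : Ordinal.{0}) : cbDeriv A α ⊆ cbDeriv B α :=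
  mapsTo_cbDeriv continuousOn_id (injOn_id A) h α

/-- Accumulation is a local property, hence so is membership in a derivative. -/
theorem mem_cbDeriv_inter {A U : Set X} (hU : IsOpen U) {α : Ordinal.{0}} {x : X}
    (hx : x ∈ cbDeriv A α) (hxU : x ∈ U) : x ∈ cbDeriv (A ∩ U) α := by
  induction α using WellFoundedLT.induction generalizing x with
  | ind α ih =>
    refine mem_cbDeriv.2 ⟨⟨cbDeriv_subset A α hx, hxU⟩, fun β hβ => ?_⟩
    have hacc := cbDeriv_subset_derivedSet A hβ hx
    rw [mem_derivedSet, accPt_iff_nhds] at hacc ⊢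
    intro V hV
    obtain ⟨y, ⟨⟨hyV, hyU⟩, hy⟩, hne⟩ := hacc (V ∩ U) (inter_mem hV (hU.mem_nhds hxU))
    exact ⟨y, ⟨hyV, ih β hβ hy hyU⟩, hne⟩

/-- For `α ≠ 0` the derivative is a decreasing intersection of nonempty compact sets. -/
theorem cbDeriv_nonempty [CompactSpace X] [T1Space X] {A : Set X} (hA : IsClosed A)
    (hne : A.Nonempty) {α : Ordinal.{0}}
    (h : ∀ β < α, (derivedSet (cbDeriv A β)).Nonempty) : (cbDeriv A α).Nonempty := by
  rcases eq_or_ne α 0 with rfl | h0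
  · rwa [cbDeriv_zero]
  have : cbDeriv A α = ⋂ β : Iio α, derivedSet (cbDeriv A β) := by
    ext x
    simp only [mem_cbDeriv, mem_iInter, Subtype.forall, mem_Iio]
    refine ⟨fun h => h.2, fun h => ⟨?_, h⟩⟩
    exact derivedSet_subset_of_isClosed hA (cbDeriv_subset A 0) (h 0 (pos_iff_ne_zero.2 h0))
  rw [this]
  have : Nonempty (Iio α) := ⟨⟨0, pos_iff_ne_zero.2 h0⟩⟩
  refine IsCompact.nonempty_iInter_of_directed_nonempty_isCompact_isClosed _ ?_ (fun β => h β β.2)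
    (fun β => (isClosed_derivedSet _).isCompact) (fun β => isClosed_derivedSet _)
  refine Antitone.directed_ge fun β γ hβγ => ?_
  exact derivedSet_mono _ _ (cbDeriv_antitone A hβγ)

/-- A nonempty perfect set contains a copy of the Cantor space, which is uncountable. -/
theorem not_preperfect_of_countable [CompactSpace X] [MetrizableSpace X] {A : Set X}
    (hA : IsClosed A) (hne : A.Nonempty) (hc : A.Countable) : ¬ A ⊆ derivedSet A := by
  intro h
  let _ := TopologicalSpace.metrizableSpaceMetric X
  have hp : Perfect A := ⟨hA, preperfect_iff_subset_derivedSet.2 h⟩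
  obtain ⟨f, hf, -, hfi⟩ := hp.exists_nat_bool_injection hne
  have : (range f).Countable := hc.mono hf
  rw [← image_univ] at this
  have := countable_of_injective_of_countable_image hfi.injOn this
  exact absurd (countable_univ_iff.1 this) (not_countable_iff.2 (by
    rw [← Cardinal.aleph0_lt_mk_iff]
    simpa using Cardinal.cantor Cardinal.aleph0))

theorem exists_cbRank {X : Type} [TopologicalSpace X] [CompactSpace X] [MetrizableSpace X] {A : Set X} (hA : IsClosed A)
    (hne : A.Nonempty) (hc : A.Countable) :
    ∃ α : Ordinal.{0}, (cbDeriv A α).Nonempty ∧ derivedSet (cbDeriv A α) = ∅ := by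
  have hex : ∃ α : Ordinal.{0}, derivedSet (cbDeriv A α) = ∅ := by
    -- The ordinals do not inject into the subsets of `X`, so the derivatives repeat. A repeated
    -- derivative is contained in its own derived set, hence empty by countability.
    obtain ⟨α, β, hlt, heq⟩ : ∃ α β : Ordinal.{0}, α < β ∧ cbDeriv A α = cbDeriv A β := by
      have := not_injective_of_ordinal (cbDeriv A)
      simp only [Function.Injective, not_forall] at this
      obtain ⟨α, β, heq, hn⟩ := this
      rcases lt_or_gt_of_ne hn with h | h
      · exact ⟨α, β, h, heq⟩
      · exact ⟨β, α, h, heq.symm⟩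
    have hsub := cbDeriv_subset_derivedSet A hlt
    rw [← heq] at hsub
    refine ⟨α, ?_⟩
    have hempty : cbDeriv A α = ∅ := by
      by_contra h
      exact not_preperfect_of_countable (isClosed_cbDeriv hA α) (nonempty_iff_ne_empty.2 h)
        (hc.mono (cbDeriv_subset A α)) hsub
    rw [hempty]
    exact subset_empty_iff.1 (derivedSet_subset_of_isClosed isClosed_empty le_rfl)
  obtain ⟨α, hα, hmin⟩ := WellFounded.has_min wellFounded_lt
    {α : Ordinal.{0} | derivedSet (cbDeriv A α) = ∅} hex
  exact ⟨α, cbDeriv_nonempty hA hne fun β hβ => nonempty_iff_ne_empty.2 fun h => hmin β h hβ, hα⟩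

theorem finite_of_derivedSet_eq_empty [CompactSpace X] {A : Set X} (hA : IsClosed A)
    (h : derivedSet A = ∅) : A.Finite := by
  by_contra hinf
  obtain ⟨x, hx, hacc⟩ := Set.Infinite.exists_accPt_of_subset_isCompact hinf hA.isCompact le_rfl
  have : x ∈ derivedSet A := hacc
  simp [h] at this

/-- The preimage of a closed set is the projection of a compact part of the graph. -/
theorem continuousOn_of_isClosed_graph [CompactSpace X] [T2Space X] [CompactSpace Y] [T2Space Y]
    {A : Set X} {f : X → Y}
    (h : IsClosed {p : X × Y | p.1 ∈ A ∧ p.2 = f p.1}) : ContinuousOn f A := by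
  rw [continuousOn_iff_isClosed]
  intro t ht
  refine ⟨Prod.fst '' ({p : X × Y | p.1 ∈ A ∧ p.2 = f p.1} ∩ Prod.snd ⁻¹' t),
    ((h.inter (ht.preimage continuous_snd)).isCompact.image continuous_fst).isClosed, ?_⟩
  ext x
  constructor
  · rintro ⟨hx, hxA⟩
    exact ⟨⟨(x, f x), ⟨⟨hxA, rfl⟩, hx⟩, rfl⟩, hxA⟩
  · rintro ⟨⟨⟨x', y⟩, ⟨⟨hA, he⟩, ht⟩, rfl⟩, hxA⟩
    simp only at he
    subst he
    exact ⟨ht, hxA⟩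

end CantorBendixson

/-! ### The topology of approximations; sets as closed subsets -/

namespace AS

instance (n : ℕ) : TopologicalSpace (HF n) := ⊥

instance (n : ℕ) : DiscreteTopology (HF n) := ⟨rfl⟩

/-- The topology of approximations. -/
instance : TopologicalSpace ASet := .induced ASet.approx inferInstance

theorem continuous_approx (n : ℕ) : Continuous fun x : ASet => x.approx n :=
  (continuous_apply n).comp continuous_induced_dom

theorem continuous_of_approx {X : Type*} [TopologicalSpace X] {f : X → ASet}
    (h : ∀ n, Continuous fun x => (f x).approx n) : Continuous f :=
  continuous_induced_rng.2 (continuous_pi h)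

theorem range_approx : range ASet.approx = {f : ∀ n, HF n | ∀ n, HF.trunc n (f (n + 1)) = f n} := by
  ext f
  exact ⟨fun ⟨x, hx⟩ => hx ▸ x.coherent, fun h => ⟨⟨f, h⟩, rfl⟩⟩

theorem isClosedEmbedding_approx : IsClosedEmbedding ASet.approx := by
  refine ⟨⟨⟨rfl⟩, fun x y h => ASet.ext h⟩, ?_⟩
  rw [range_approx, ofPred_forall]
  refine isClosed_iInter fun n => isClosed_eq ?_ (continuous_apply n)
  exact continuous_of_discreteTopology.comp (continuous_apply (n + 1))

instance : CompactSpace ASet := isClosedEmbedding_approx.compactSpace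

instance : MetrizableSpace ASet := isClosedEmbedding_approx.isEmbedding.metrizableSpace

theorem InNhd.trans {n : ℕ} {x y z : ASet} (h : InNhd n x y) (h' : InNhd n y z) : InNhd n x z :=
  Eq.trans h' h

theorem inNhd_refl (n : ℕ) (x : ASet) : InNhd n x x := rfl

theorem InNhd.mono {m n : ℕ} {x y : ASet} (h : InNhd n x y) (hmn : m ≤ n) : InNhd m x y := by
  induction n, hmn using Nat.le_induction with
  | base => exact h
  | succ n _ ih =>
    apply ih
    have h : y.approx (n + 1) = x.approx (n + 1) := h
    have : y.approx n = x.approx n := by rw [← x.coherent, ← y.coherent, h]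
    exact this

theorem isClopen_inNhd (n : ℕ) (x : ASet) : IsClopen {y | InNhd n x y} :=
  (isClopen_discrete {x.approx n}).preimage (continuous_approx n)

theorem eq_of_forall_inNhd {x y : ASet} (h : ∀ n, InNhd n x y) : x = y :=
  ASet.ext (funext fun n => (h n).symm)

theorem nhds_hasBasis (x : ASet) : (𝓝 x).HasBasis (fun _ : ℕ => True) fun n => {y | InNhd n x y} := by
  refine ⟨fun t => ⟨fun ht => ?_, fun ⟨n, _, hn⟩ =>
    mem_of_superset ((isClopen_inNhd n x).isOpen.mem_nhds (inNhd_refl n x)) hn⟩⟩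
  rw [nhds_induced, mem_comap] at ht
  obtain ⟨u, hu, hut⟩ := ht
  rw [nhds_pi, mem_pi'] at hu
  obtain ⟨I, s, hs, hsu⟩ := hu
  refine ⟨I.sup id, trivial, fun y hy => hut (hsu fun i hi => ?_)⟩
  have : y.approx i = x.approx i := InNhd.mono hy (Finset.le_sup (f := id) hi)
  rw [this]
  exact mem_of_mem_nhds (hs i)

theorem mem_derivedSet_iff {S : Set ASet} {x : ASet} :
    x ∈ derivedSet S ↔ ∀ n, ∃ y ∈ S, y ≠ x ∧ InNhd n x y := by
  rw [mem_derivedSet, accPt_iff_nhds]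
  constructor
  · intro h n
    obtain ⟨y, ⟨hy, hyS⟩, hne⟩ := h _ ((nhds_hasBasis x).mem_of_mem (i := n) trivial)
    exact ⟨y, hyS, hne, hy⟩
  · intro h U hU
    obtain ⟨n, -, hn⟩ := (nhds_hasBasis x).mem_iff.1 hU
    obtain ⟨y, hy, hne, hxy⟩ := h n
    exact ⟨y, ⟨hn hxy, hy⟩, hne⟩

theorem mem_closure_iff_inNhd {S : Set ASet} {x : ASet} :
    x ∈ closure S ↔ ∀ n, ∃ y ∈ S, InNhd n x y := by
  rw [mem_closure_iff_nhds_basis (nhds_hasBasis x)]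
  simp [and_comm]

/-- The set of elements of `A`. -/
def ASet.pts (A : ASet) : Set ASet := {x | x ∈ A}

@[simp] theorem mem_pts {A x : ASet} : x ∈ A.pts ↔ x ∈ A := Iff.rfl

theorem mem_hull_iff {P : ASet → Prop} {x : ASet} : x ∈ hull P ↔ x ∈ closure {y | P y} := by
  rw [mem_closure_iff_inNhd]
  exact Iff.rfl

theorem mem_hull_of_isClosed {P : ASet → Prop} (h : IsClosed {y | P y}) {x : ASet} :
    x ∈ hull P ↔ P x := by
  rw [mem_hull_iff, h.closure_eq]; rfl

theorem pts_hull (P : ASet → Prop) : (hull P).pts = closure {y | P y} := ext fun _ => mem_hull_iff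

theorem isClosed_pts (A : ASet) : IsClosed A.pts := by
  have : A.pts = ⋂ n, (fun x : ASet => x.approx n) ⁻¹' A.level n := by
    ext x
    simp only [mem_iInter]
    exact Iff.rfl
  rw [this]
  exact isClosed_iInter fun n => (isClosed_discrete _).preimage (continuous_approx n)

theorem exists_approx_eq : ∀ {n : ℕ} (a : HF n), ∃ x : ASet, x.approx n = a
  | 0, a => ⟨∅, Subsingleton.elim (α := Unit) _ _⟩
  | n + 1, a => by
    refine ⟨hull fun x => x.approx n ∈ (show Set (HF n) from a), ?_⟩
    change ({b | ∃ x : ASet, x.approx n ∈ (show Set (HF n) from a) ∧ x.approx n = b} :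
      Set (HF n)) = a
    ext b
    constructor
    · rintro ⟨x, hx, rfl⟩
      exact hx
    · intro hb
      obtain ⟨x, rfl⟩ := exists_approx_eq b
      exact ⟨x, hb, rfl⟩

theorem ASet.trunc_image_level (A : ASet) (n : ℕ) :
    HF.trunc n '' A.level (n + 1) = A.level n := A.coherent (n + 1)

/-- A König argument: by coherence `a` extends to arbitrarily deep approximations that fit `A`, and
compactness yields a point fitting all of them. Extensionality follows, since the elements determine
every level. -/
theorem exists_mem_approx (A : ASet) {n : ℕ} {a : HF n} (ha : a ∈ A.level n) :
    ∃ x ∈ A, x.approx n = a := by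
  have hcl : ∀ m, IsClosed {x : ASet | x.approx n = a ∧ x.approx (n + m) ∈ A.level (n + m)} :=
    fun m => ((isClosed_discrete {a}).preimage (continuous_approx n)).inter
      ((isClosed_discrete (A.level (n + m))).preimage (continuous_approx (n + m)))
  have hstep : ∀ (x : ASet) (m : ℕ), x.approx (m + 1) ∈ A.level (m + 1) →
      x.approx m ∈ A.level m := fun x m hx => by
    rw [← A.trunc_image_level, ← x.coherent]
    exact mem_image_of_mem _ hx
  have hne : ∀ m, {x : ASet | x.approx n = a ∧ x.approx (n + m) ∈ A.level (n + m)}.Nonempty := by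
    intro m
    induction m with
    | zero =>
      obtain ⟨x, hx⟩ := exists_approx_eq a
      exact ⟨x, hx, by rw [Nat.add_zero, hx]; exact ha⟩
    | succ m ih =>
      obtain ⟨x, hx, hxm⟩ := ih
      rw [← A.trunc_image_level] at hxm
      obtain ⟨b, hb, hbx⟩ := hxm
      obtain ⟨y, rfl⟩ := exists_approx_eq b
      rw [y.coherent] at hbx
      have : InNhd (n + m) x y := hbx
      exact ⟨y, Eq.trans (this.mono (Nat.le_add_right n m)) hx, hb⟩
  obtain ⟨x, hx⟩ := IsCompact.nonempty_iInter_of_sequence_nonempty_isCompact_isClosed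
    (fun m => {x : ASet | x.approx n = a ∧ x.approx (n + m) ∈ A.level (n + m)})
    (fun m x hx => ⟨hx.1, hstep x (n + m) hx.2⟩) hne (hcl 0).isCompact hcl
  rw [mem_iInter] at hx
  refine ⟨x, fun m => ?_, (hx 0).1⟩
  have h := (hx m).2
  have hdown : ∀ k, x.approx (m + k) ∈ A.level (m + k) → x.approx m ∈ A.level m := by
    intro k
    induction k with
    | zero => exact id
    | succ k ih => exact fun h => ih (hstep x (m + k) h)
  rw [Nat.add_comm] at h
  exact hdown n h

theorem aset_ext {A B : ASet} (h : ∀ x, x ∈ A ↔ x ∈ B) : A = B := by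
  ext n : 2
  cases n with
  | zero => exact Subsingleton.elim (α := Unit) _ _
  | succ n =>
    have : A.level n = B.level n := by
      ext a
      constructor
      · intro ha
        obtain ⟨x, hx, rfl⟩ := exists_mem_approx A ha
        exact (h x).1 hx n
      · intro ha
        obtain ⟨x, hx, rfl⟩ := exists_mem_approx B ha
        exact (h x).2 hx n
    exact this

theorem pts_injective : Function.Injective ASet.pts := fun _ _ h => aset_ext fun x => Set.ext_iff.1 h x

theorem not_mem_empty (x : ASet) : x ∉ (∅ : ASet) := by
  intro h
  simpa using mem_hull_iff.1 h

theorem eq_empty_iff {A : ASet} : A = ∅ ↔ A.pts = ∅ := by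
  rw [← pts_injective.eq_iff]
  have : (∅ : ASet).pts = ∅ := eq_empty_of_forall_notMem not_mem_empty
  rw [this]

theorem ne_empty_iff {A : ASet} : A ≠ ∅ ↔ A.pts.Nonempty := by
  rw [Ne, eq_empty_iff, nonempty_iff_ne_empty]

theorem mem_derived {A x : ASet} : x ∈ derived A ↔ x ∈ derivedSet A.pts := by
  have h : {x | IsAccPoint A x} = derivedSet A.pts := ext fun x => mem_derivedSet_iff.symm
  rw [derived, mem_hull_iff, h, (isClosed_derivedSet _).closure_eq]

theorem pts_derived (A : ASet) : (derived A).pts = derivedSet A.pts := ext fun _ => mem_derived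

theorem mem_pair {a b x : ASet} : x ∈ pair a b ↔ x = a ∨ x = b := by
  refine mem_hull_of_isClosed ?_
  exact (toFinite ({a, b} : Set ASet)).isClosed

theorem mem_single {a x : ASet} : x ∈ single a ↔ x = a := by
  rw [single, mem_pair, or_self]

theorem mem_union {A B x : ASet} : x ∈ union A B ↔ x ∈ A ∨ x ∈ B :=
  mem_hull_of_isClosed ((isClosed_pts A).union (isClosed_pts B))

theorem mem_inter {A B x : ASet} : x ∈ inter A B ↔ x ∈ A ∧ x ∈ B :=
  mem_hull_of_isClosed ((isClosed_pts A).inter (isClosed_pts B))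

/-- A difference of closed sets need not be closed, so the closure stays here; this is what
distinguishes limits from successors below. -/
theorem mem_diff {A B x : ASet} : x ∈ diff B A ↔ x ∈ closure (B.pts \ A.pts) := mem_hull_iff

theorem diff_subset {A B x : ASet} (h : x ∈ diff B A) : x ∈ B :=
  closure_minimal Set.sdiff_subset (isClosed_pts B) (mem_diff.1 h)

theorem pair_left_cancel {a b c d : ASet} (h : pair a b = pair c d) :
    (a = c ∧ b = d) ∨ (a = d ∧ b = c) := by
  have h' : ∀ x, (x = a ∨ x = b) ↔ (x = c ∨ x = d) := fun x => by
    rw [← mem_pair, h, mem_pair]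
  have h1 := h' a
  have h2 := h' b
  have h3 := h' c
  have h4 := h' d
  grind

theorem single_injective : Function.Injective single := fun a b h => by
  have : a ∈ single b := h ▸ mem_single.2 rfl
  exact mem_single.1 this

theorem opair_inj {a b c d : ASet} : opair a b = opair c d ↔ a = c ∧ b = d := by
  refine ⟨fun h => ?_, fun ⟨h, h'⟩ => by rw [h, h']⟩
  rcases pair_left_cancel h with ⟨h1, h2⟩ | ⟨h1, h2⟩
  · have := single_injective h1
    subst this
    rcases pair_left_cancel h2 with h | ⟨h, h'⟩
    · exact h
    · exact ⟨rfl, h'.trans h⟩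
  · rcases pair_left_cancel h1 with h | h <;> rcases pair_left_cancel h2 with h' | h' <;> grind

/-- The approximation of `{a, b}` at level `n + 1` depends only on those of `a` and `b` at level
`n`. -/
theorem continuous_pair : Continuous fun p : ASet × ASet => pair p.1 p.2 := by
  refine continuous_of_approx fun n => ?_
  cases n with
  | zero => exact continuous_const (y := ((pair ∅ ∅).approx 0 : HF 0))
  | succ n =>
    have : (fun p : ASet × ASet => (pair p.1 p.2).approx (n + 1)) =
        (fun q : HF n × HF n => (({q.1, q.2} : Set (HF n)) : HF (n + 1))) ∘
          fun p : ASet × ASet => (p.1.approx n, p.2.approx n) := by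
      funext p
      change ({a | ∃ x, (x = p.1 ∨ x = p.2) ∧ x.approx n = a} : Set (HF n)) =
        {p.1.approx n, p.2.approx n}
      ext a
      simp [or_and_right, exists_or, eq_comm]
    rw [this]
    refine continuous_of_discreteTopology.comp ?_
    exact ((continuous_approx n).comp continuous_fst).prodMk
      ((continuous_approx n).comp continuous_snd)

theorem continuous_opair : Continuous fun p : ASet × ASet => opair p.1 p.2 :=
  continuous_pair.comp ((continuous_pair.comp (continuous_fst.prodMk continuous_fst)).prodMk
    continuous_pair)

theorem isClosedEmbedding_opair : IsClosedEmbedding fun p : ASet × ASet => opair p.1 p.2 :=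
  continuous_opair.isClosedEmbedding fun _ _ h =>
    Prod.ext (opair_inj.1 h).1 (opair_inj.1 h).2

theorem pts_prod (A B : ASet) :
    (prod A B).pts = (fun p : ASet × ASet => opair p.1 p.2) '' (A.pts ×ˢ B.pts) := by
  have h : {z | ∃ a ∈ A, ∃ b ∈ B, z = opair a b} =
      (fun p : ASet × ASet => opair p.1 p.2) '' (A.pts ×ˢ B.pts) := by
    ext z
    simp only [mem_ofPred_eq, mem_image, Prod.exists, mem_prod, mem_pts]
    constructor
    · rintro ⟨a, ha, b, hb, rfl⟩
      exact ⟨a, b, ⟨ha, hb⟩, rfl⟩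
    · rintro ⟨a, b, ⟨ha, hb⟩, rfl⟩
      exact ⟨a, ha, b, hb, rfl⟩
  rw [prod, pts_hull, h]
  exact (isClosedEmbedding_opair.isClosedMap _ ((isClosed_pts A).prod (isClosed_pts B))).closure_eq

theorem mem_prod_iff {A B x : ASet} : x ∈ prod A B ↔ ∃ a ∈ A, ∃ b ∈ B, x = opair a b := by
  rw [← mem_pts, pts_prod]
  constructor
  · rintro ⟨⟨a, b⟩, ⟨ha, hb⟩, rfl⟩
    exact ⟨a, ha, b, hb, rfl⟩
  · rintro ⟨a, ha, b, hb, rfl⟩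
    exact ⟨(a, b), ⟨ha, hb⟩, rfl⟩

theorem opair_mem_prod {A B a b : ASet} : opair a b ∈ prod A B ↔ a ∈ A ∧ b ∈ B := by
  rw [mem_prod_iff]
  constructor
  · rintro ⟨a', ha, b', hb, h⟩
    obtain ⟨rfl, rfl⟩ := opair_inj.1 h
    exact ⟨ha, hb⟩
  · rintro ⟨ha, hb⟩
    exact ⟨a, ha, b, hb, rfl⟩

theorem isClosed_setOf_opair_mem (f : ASet) : IsClosed {p : ASet × ASet | opair p.1 p.2 ∈ f} :=
  (isClosed_pts f).preimage continuous_opair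

/-! ### Injections of the universe as continuous injections -/

/-- A continuous injection between the point sets of two sets. -/
structure Embeds (g : ASet → ASet) (A B : Set ASet) : Prop where
  continuousOn : ContinuousOn g A
  injOn : InjOn g A
  mapsTo : MapsTo g A B

theorem IsInjection.exists_embeds {f A B : ASet} (h : IsInjection f A B) :
    ∃ g, Embeds g A.pts B.pts ∧ ∀ a ∈ A, opair a (g a) ∈ f := by
  have : ∀ a, ∃ b, a ∈ A → b ∈ B ∧ opair a b ∈ f := fun a => by
    by_cases ha : a ∈ A
    · obtain ⟨b, hb⟩ := h.total a ha
      exact ⟨b, fun _ => hb⟩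
    · exact ⟨∅, fun h => absurd h ha⟩
  choose g hg using this
  refine ⟨g, ⟨?_, ?_, fun a ha => (hg a ha).1⟩, fun a ha => (hg a ha).2⟩
  · refine continuousOn_of_isClosed_graph ?_
    convert isClosed_setOf_opair_mem f using 1
    ext ⟨a, b⟩
    constructor
    · rintro ⟨ha, hb⟩
      simp only at ha hb
      subst hb
      exact (hg a ha).2
    · intro hab
      have ha := (opair_mem_prod.1 (h.subset _ hab)).1
      exact ⟨ha, h.functional _ _ _ hab (hg a ha).2⟩
  · intro a ha a' ha' heq
    have h' := (hg a' ha').2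
    rw [← heq] at h'
    exact h.injective _ _ _ (hg a ha).2 h'

/-- An injection that is a set has a closed graph and so is continuous; conversely, the graph of a
continuous map on a compact set is compact and thus forms a set. -/
theorem cardLE_iff {A B : ASet} : CardLE A B ↔ ∃ g, Embeds g A.pts B.pts := by
  constructor
  · rintro ⟨f, hf⟩
    obtain ⟨g, hg, -⟩ := hf.exists_embeds
    exact ⟨g, hg⟩
  · rintro ⟨g, hg⟩
    have hcl : IsClosed {z | ∃ a ∈ A, z = opair a (g a)} := by
      have : {z | ∃ a ∈ A, z = opair a (g a)} = (fun a => opair a (g a)) '' A.pts := by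
        ext z
        simp [eq_comm]
      rw [this]
      refine ((isClosed_pts A).isCompact.image_of_continuousOn ?_).isClosed
      exact continuous_opair.comp_continuousOn (continuousOn_id.prodMk hg.continuousOn)
    have hmem : ∀ a b, opair a b ∈ hull (fun z => ∃ a ∈ A, z = opair a (g a)) ↔
        a ∈ A ∧ b = g a := fun a b => by
      rw [mem_hull_of_isClosed hcl]
      constructor
      · rintro ⟨a', ha', h⟩
        obtain ⟨rfl, rfl⟩ := opair_inj.1 h
        exact ⟨ha', rfl⟩
      · rintro ⟨ha, rfl⟩
        exact ⟨a, ha, rfl⟩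
    refine ⟨hull fun z => ∃ a ∈ A, z = opair a (g a), ⟨?_, ?_, ?_, ?_⟩⟩
    · intro z hz
      obtain ⟨a, ha, rfl⟩ := (mem_hull_of_isClosed hcl).1 hz
      exact opair_mem_prod.2 ⟨ha, hg.mapsTo ha⟩
    · exact fun a ha => ⟨g a, hg.mapsTo ha, (hmem _ _).2 ⟨ha, rfl⟩⟩
    · intro a b b' h h'
      rw [((hmem _ _).1 h).2, ((hmem _ _).1 h').2]
    · intro a a' b h h'
      rw [hmem] at h h'
      exact hg.injOn h.1 h'.1 (h.2.symm.trans h'.2)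

end AS

/-! ### Absorption of sets of small rank -/

namespace AS

theorem Embeds.mono {g : ASet → ASet} {A A' B B' : Set ASet} (h : Embeds g A B) (hA : A' ⊆ A)
    (hB : B ⊆ B') : Embeds g A' B' :=
  ⟨h.continuousOn.mono hA, h.injOn.mono hA, fun _ hx => hB (h.mapsTo (hA hx))⟩

theorem Embeds.comp {f g : ASet → ASet} {A B C : Set ASet} (hf : Embeds f B C)
    (hg : Embeds g A B) : Embeds (f ∘ g) A C :=
  ⟨hf.continuousOn.comp hg.continuousOn hg.mapsTo, hf.injOn.comp hg.injOn hg.mapsTo,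
    hf.mapsTo.comp hg.mapsTo⟩

theorem embeds_empty (g : ASet → ASet) (B : Set ASet) : Embeds g ∅ B :=
  ⟨continuousOn_empty g, injOn_empty g, mapsTo_empty g B⟩

theorem Embeds.congr {f g : ASet → ASet} {A B : Set ASet} (hf : Embeds f A B) (h : EqOn g f A) :
    Embeds g A B :=
  ⟨hf.continuousOn.congr h, hf.injOn.congr h.symm, hf.mapsTo.congr h.symm⟩

theorem Embeds.exists_union {f g : ASet → ASet} {A A' B : Set ASet} (hf : Embeds f A B)
    (hg : Embeds g A' B) (hA : IsClosed A) (hA' : IsClosed A') (hd : Disjoint A A')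
    (hne : ∀ x ∈ A, ∀ y ∈ A', f x ≠ g y) : ∃ k, Embeds k (A ∪ A') B := by
  classical
  have h1 : EqOn (A.piecewise f g) f A := piecewise_eqOn A f g
  have h2 : EqOn (A.piecewise f g) g A' := fun x hx =>
    piecewise_eq_of_notMem A f g fun h => disjoint_left.1 hd h hx
  have e1 := hf.congr h1
  have e2 := hg.congr h2
  refine ⟨A.piecewise f g, e1.continuousOn.union_of_isClosed e2.continuousOn hA hA', ?_,
    e1.mapsTo.union e2.mapsTo⟩
  refine (injOn_union hd).2 ⟨e1.injOn, e2.injOn, fun x hx y hy => ?_⟩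
  rw [h1 hx, h2 hy]
  exact hne x hx y hy

/-- The image is compact and misses `y`, so it leaves a neighbourhood of `y` free. Further pieces
can be placed there. -/
theorem Embeds.exists_forall_not_inNhd {g : ASet → ASet} {A B : Set ASet} {y : ASet}
    (hg : Embeds g A B) (hA : IsClosed A) (hy : y ∉ B) :
    ∃ M, ∀ n ≥ M, ∀ x ∈ A, ¬ InNhd n y (g x) := by
  have hcl : IsClosed (g '' A) := (hA.isCompact.image_of_continuousOn hg.continuousOn).isClosed
  have hnm : y ∉ closure (g '' A) := by
    rw [hcl.closure_eq]
    rintro ⟨x, hx, rfl⟩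
    exact hy (hg.mapsTo hx)
  rw [mem_closure_iff_inNhd] at hnm
  push Not at hnm
  obtain ⟨M, hM⟩ := hnm
  exact ⟨M, fun n hn x hx h => hM _ (mem_image_of_mem g hx) (h.mono hn)⟩

/-- The points of `Y` in the `n`th basic neighbourhood of `y`. -/
def nhdIn (Y : Set ASet) (n : ℕ) (y : ASet) : Set ASet := {z ∈ Y | InNhd n y z}

/-- Every closed set whose `α`th derivative is empty embeds into every punctured neighbourhood
of a point of an `α`th derivative. -/
def PuncturedAbsorption (α : Ordinal.{0}) : Prop :=
  ∀ X : Set ASet, IsClosed X → cbDeriv X α = ∅ → ∀ (Y : Set ASet) (y : ASet), y ∈ cbDeriv Y α →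
    ∀ N, ∃ g, Embeds g X (nhdIn Y N y \ {y})

/-- Every closed set whose `α`th derivative has at most the point `x` embeds into every
neighbourhood of a point `y` of an `α`th derivative, with `x` going to `y`. -/
def PointedAbsorption (α : Ordinal.{0}) : Prop :=
  ∀ (X : Set ASet) (x : ASet), IsClosed X → cbDeriv X α ⊆ {x} →
    ∀ (Y : Set ASet) (y : ASet), y ∈ cbDeriv Y α → ∀ N, ∃ g, Embeds g X (nhdIn Y N y) ∧ g x = y

theorem isClosed_sep_inNhd {X : Set ASet} (hX : IsClosed X) (n : ℕ) (x : ASet) :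
    IsClosed (nhdIn X n x) :=
  hX.inter (isClopen_inNhd n x).isClosed

theorem isClosed_annulus {X : Set ASet} (hX : IsClosed X) (n : ℕ) (x : ASet) :
    IsClosed {z ∈ X | InNhd n x z ∧ ¬ InNhd (n + 1) x z} :=
  hX.inter ((isClopen_inNhd n x).isClosed.inter (isClopen_inNhd (n + 1) x).compl.isClosed)

theorem exists_annulus {x z : ASet} (h : z ≠ x) : ∃ k, InNhd k x z ∧ ¬ InNhd (k + 1) x z := by
  by_contra! hk
  refine h (eq_of_forall_inNhd fun n => ?_).symm
  induction n with
  | zero => exact Subsingleton.elim (α := Unit) _ _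
  | succ n ih => exact hk n ih

theorem annulus_unique {x z : ASet} {k l : ℕ} (h : InNhd k x z ∧ ¬ InNhd (k + 1) x z)
    (h' : InNhd l x z ∧ ¬ InNhd (l + 1) x z) : k = l := by
  rcases lt_trichotomy k l with hlt | heq | hlt
  · exact absurd (h'.1.mono hlt) h.2
  · exact heq
  · exact absurd (h.1.mono hlt) h'.2

/-- Cut `X \ {x}` into annuli around `x` and embed them one after another, each closer to `y` than
the previous ones. The images are disjoint and shrink to `y`, so `x ↦ y` extends the map
continuously. -/
theorem PuncturedAbsorption.pointed {α : Ordinal.{0}} (h : PuncturedAbsorption α) :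
    PointedAbsorption α := by
  classical
  intro X x hX hXx Y y hy N
  let R : ℕ → Set ASet := fun k => {z | InNhd k x z ∧ ¬ InNhd (k + 1) x z}
  have hRopen : ∀ k, IsOpen (R k) := fun k =>
    (isClopen_inNhd k x).isOpen.inter (isClopen_inNhd (k + 1) x).compl.isOpen
  have hstep : ∀ k M, ∃ g M', M < M' ∧ Embeds g (X ∩ R k) (nhdIn Y M y \ {y}) ∧
      ∀ z ∈ X ∩ R k, ¬ InNhd M' y (g z) := by
    intro k M
    have hcl : IsClosed (X ∩ R k) := isClosed_annulus hX k x
    -- Only `x` could lie in this derivative, and `x` lies in no annulus.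
    have hempty : cbDeriv (X ∩ R k) α = ∅ := by
      refine eq_empty_of_forall_notMem fun z hz => ?_
      have hzx : z = x := hXx (cbDeriv_mono inter_subset_left α hz)
      have := (cbDeriv_subset _ α hz).2.2
      exact this (hzx ▸ inNhd_refl _ _)
    obtain ⟨g, hg⟩ := h _ hcl hempty Y y hy M
    obtain ⟨M', hM'⟩ := hg.exists_forall_not_inNhd hcl (y := y) (fun hy => hy.2 rfl)
    -- The bound `M + 1` makes the radii strictly increasing, so that they tend to infinity even if
    -- some annuli are empty.
    exact ⟨g, max M' (M + 1), by omega, hg, fun z hz => hM' _ (le_max_left _ _) z hz⟩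
  choose G L hL hG hGL using hstep
  let M : ℕ → ℕ := fun k => Nat.rec N (fun k m => L k m) k
  have hMlt : StrictMono M := strictMono_nat_of_lt_succ fun k => hL k (M k)
  let f : ASet → ASet := fun z => if hz : ∃ k, z ∈ R k then G hz.choose (M hz.choose) z else y
  have hfR : ∀ k, ∀ z ∈ R k, f z = G k (M k) z := by
    intro k z hz
    have hex : ∃ k, z ∈ R k := ⟨k, hz⟩
    have : hex.choose = k := annulus_unique hex.choose_spec hz
    simp only [f, dif_pos hex, this]
  have hfx : f x = y := dif_neg fun ⟨k, hk⟩ => hk.2 (inNhd_refl _ _)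
  have hcase : ∀ z, z ≠ x → ∃ k, z ∈ R k := fun z hz => exists_annulus hz
  have hfmem : ∀ k, ∀ z ∈ X ∩ R k, f z ∈ nhdIn Y (M k) y \ {y} := fun k z hz => by
    rw [hfR k z hz.2]
    exact (hG k (M k)).mapsTo hz
  have hfnot : ∀ k, ∀ z ∈ X ∩ R k, ¬ InNhd (M (k + 1)) y (f z) := fun k z hz => by
    rw [hfR k z hz.2]
    exact hGL k (M k) z hz
  have hlt : ∀ k l, k < l → ∀ z ∈ X ∩ R k, ∀ w ∈ X ∩ R l, f z ≠ f w := by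
    intro k l hkl z hz w hw heq
    refine hfnot k z hz ?_
    rw [heq]
    exact (hfmem l w hw).1.2.mono (hMlt.monotone hkl)
  refine ⟨f, ⟨?_, ?_, ?_⟩, hfx⟩
  · intro z hz
    by_cases hzx : z = x
    · subst hzx
      rw [ContinuousWithinAt, hfx, (nhds_hasBasis y).tendsto_right_iff]
      intro n _
      have hn : {w | InNhd n z w} ∈ 𝓝[X] z :=
        mem_nhdsWithin_of_mem_nhds ((nhds_hasBasis z).mem_of_mem trivial)
      filter_upwards [hn, self_mem_nhdsWithin] with w hw hwX
      by_cases hwz : w = z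
      · rw [hwz, hfx]
        exact inNhd_refl _ _
      · obtain ⟨k, hk⟩ := hcase w hwz
        have hnk : n ≤ k := by
          by_contra! hlt
          exact hk.2 (InNhd.mono hw hlt)
        exact (hfmem k w ⟨hwX, hk⟩).1.2.mono (hnk.trans hMlt.le_apply)
    · obtain ⟨k, hk⟩ := hcase z hzx
      rw [← continuousWithinAt_inter ((hRopen k).mem_nhds hk)]
      exact ((hG k (M k)).continuousOn z ⟨hz, hk⟩).congr (fun w hw => hfR k w hw.2) (hfR k z hk)
  · intro z hz w hw heq
    by_cases hzx : z = x
    · by_cases hwx : w = x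
      · rw [hzx, hwx]
      · obtain ⟨l, hl⟩ := hcase w hwx
        rw [hzx, hfx] at heq
        exact absurd heq.symm (hfmem l w ⟨hw, hl⟩).2
    · obtain ⟨k, hk⟩ := hcase z hzx
      by_cases hwx : w = x
      · rw [hwx, hfx] at heq
        exact absurd heq (hfmem k z ⟨hz, hk⟩).2
      · obtain ⟨l, hl⟩ := hcase w hwx
        rcases lt_trichotomy k l with hkl | rfl | hkl
        · exact absurd heq (hlt k l hkl z ⟨hz, hk⟩ w ⟨hw, hl⟩)
        · rw [hfR k z hk, hfR k w hl] at heq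
          exact (hG k (M k)).injOn ⟨hz, hk⟩ ⟨hw, hl⟩ heq
        · exact absurd heq.symm (hlt l k hkl w ⟨hw, hl⟩ z ⟨hz, hk⟩)
  · intro z hz
    by_cases hzx : z = x
    · rw [hzx, hfx]
      exact ⟨cbDeriv_subset Y α hy, inNhd_refl _ _⟩
    · obtain ⟨k, hk⟩ := hcase z hzx
      have := (hfmem k z ⟨hz, hk⟩).1
      exact ⟨this.1, this.2.mono (hMlt.monotone (Nat.zero_le k))⟩

/-- Near each of its points `x`, the set `X` has a `β`th derivative contained in `{x}` for some `β <
α`. As `y` is an accumulation point of the `β`th derivative of `Y`, this piece fits near some other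
point `y'` close to `y`. By compactness finitely many pieces suffice. -/
theorem puncturedAbsorption_of_lt {α : Ordinal.{0}} (h : ∀ β < α, PointedAbsorption β) :
    PuncturedAbsorption α := by
  intro X hX hempty
  let Q : Set ASet → Prop := fun C => ∀ (Y : Set ASet) (y : ASet), y ∈ cbDeriv Y α →
    ∀ N, ∃ g, Embeds g C (nhdIn Y N y \ {y})
  have hQmono : ∀ C C', C' ⊆ C → Q C → Q C' := fun C C' hC hQ Y y hy N => by
    obtain ⟨g, hg⟩ := hQ Y y hy N
    exact ⟨g, hg.mono hC le_rfl⟩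
  have hQempty : Q ∅ := fun Y y _ N => ⟨id, embeds_empty _ _⟩
  have hloc : ∀ x, ∃ n, Q (nhdIn X n x) := by
    intro x
    by_cases hx : x ∈ X
    · have hnot : x ∉ cbDeriv X α := by simp [hempty]
      rw [mem_cbDeriv] at hnot
      push Not at hnot
      obtain ⟨β, hβ, hxβ⟩ := hnot hx
      rw [mem_derivedSet_iff] at hxβ
      push Not at hxβ
      obtain ⟨n, hn⟩ := hxβ
      refine ⟨n, fun Y y hy N => ?_⟩
      obtain ⟨y', hy', hne, hyN⟩ := mem_derivedSet_iff.1 (cbDeriv_subset_derivedSet Y hβ hy) N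
      -- The `k`th neighbourhood of `y'` keeps the copy away from `y` itself.
      obtain ⟨k, hk⟩ : ∃ k, ¬ InNhd k y' y := by
        by_contra! hk
        exact hne (eq_of_forall_inNhd hk)
      have hsub : cbDeriv (nhdIn X n x) β ⊆ {x} := fun z hz => by
        by_contra hzx
        exact hn z (cbDeriv_mono (sep_subset _ _) β hz) hzx (cbDeriv_subset _ β hz).2
      obtain ⟨g, hg, -⟩ := h β hβ _ x (isClosed_sep_inNhd hX n x) hsub Y y' hy' (max N k)
      refine ⟨g, hg.mono le_rfl fun z hz => ⟨⟨hz.1, ?_⟩, ?_⟩⟩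
      · exact hyN.trans (hz.2.mono (le_max_left _ _))
      · rintro rfl
        exact hk (hz.2.mono (le_max_right _ _))
    · rw [← hX.closure_eq, mem_closure_iff_inNhd] at hx
      push Not at hx
      obtain ⟨n, hn⟩ := hx
      refine ⟨n, hQmono _ _ (fun z hz => ?_) hQempty⟩
      exact absurd hz.2 (hn z hz.1)
  obtain ⟨n, hn⟩ : ∃ n, ∀ x, Q (nhdIn X n x) := by
    obtain ⟨n, hn⟩ := isCompact_univ.elim_directed_cover (fun n => {x | Q (nhdIn X n x)})
      (fun n => by
        rw [isOpen_iff_mem_nhds]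
        intro x hx
        refine mem_of_superset ((nhds_hasBasis x).mem_of_mem (i := n) trivial) fun y hy => ?_
        exact hQmono (nhdIn X n x) (nhdIn X n y) (fun z hz => ⟨hz.1, InNhd.trans hy hz.2⟩) hx)
      (fun x _ => mem_iUnion.2 (hloc x))
      (Monotone.directed_le fun m n hmn x hx =>
        hQmono (nhdIn X m x) (nhdIn X n x) (fun z hz => ⟨hz.1, hz.2.mono hmn⟩) hx)
    exact ⟨n, fun x => hn (mem_univ x)⟩
  -- The pieces are the classes of equal `n`th approximation. They are added one at a time, each
  -- inside a neighbourhood of `y` that the image so far avoids.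
  have hfin : ∀ s : Set (HF n), Q (X ∩ (fun z : ASet => z.approx n) ⁻¹' s) := by
    intro s
    induction s, s.toFinite using Set.Finite.induction_on with
    | empty => simpa using hQempty
    | @insert a s has hs ih =>
      intro Y y hy N
      have hclosed : ∀ t : Set (HF n), IsClosed (X ∩ (fun z : ASet => z.approx n) ⁻¹' t) :=
        fun t => hX.inter ((isClosed_discrete t).preimage (continuous_approx n))
      obtain ⟨f, hf⟩ := ih Y y hy N
      obtain ⟨M, hM⟩ := hf.exists_forall_not_inNhd (hclosed s) (y := y) fun hy => hy.2 rfl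
      obtain ⟨x, rfl⟩ := exists_approx_eq a
      obtain ⟨g, hg⟩ := hn x Y y hy (max M N)
      have hg' : Embeds g (X ∩ (fun z : ASet => z.approx n) ⁻¹' {x.approx n})
          (nhdIn Y N y \ {y}) :=
        hg.mono (fun z hz => hz)
          fun z hz => ⟨⟨hz.1.1, hz.1.2.mono (le_max_right _ _)⟩, hz.2⟩
      obtain ⟨k, hk⟩ := hg'.exists_union hf (hclosed _) (hclosed _)
        (disjoint_left.2 fun z hz hz' => has (by
          have : z.approx n = x.approx n := hz.2
          rw [← this]
          exact hz'.2))
        (fun z hz w hw heq => hM _ (le_max_left M N) w hw (heq ▸ (hg.mapsTo hz).1.2))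
      refine ⟨k, hk.mono (fun z hz => ?_) le_rfl⟩
      rw [insert_eq, preimage_union, inter_union_distrib_left] at hz
      exact hz
  simpa using hfin univ

theorem pointedAbsorption (α : Ordinal.{0}) : PointedAbsorption α := by
  induction α using WellFoundedLT.induction with
  | ind α ih => exact (puncturedAbsorption_of_lt ih).pointed

end AS

/-! ### Derivatives of images and of disjoint unions -/

section Transport

variable {X Y : Type*} [TopologicalSpace X] [TopologicalSpace Y]

theorem continuousOn_invFun [CompactSpace X] [T2Space X] [CompactSpace Y] [T2Space Y] [Nonempty X]
    {f : X → Y} (hf : Continuous f) (hinj : Function.Injective f) :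
    ContinuousOn (Function.invFun f) (range f) := by
  refine continuousOn_of_isClosed_graph ?_
  have : {p : Y × X | p.1 ∈ range f ∧ p.2 = Function.invFun f p.1} = {p | p.1 = f p.2} := by
    ext ⟨y, x⟩
    constructor
    · rintro ⟨⟨x', rfl⟩, h⟩
      simp only at h
      rw [Function.leftInverse_invFun hinj] at h
      exact congrArg f h.symm
    · intro h
      obtain rfl : y = f x := h
      exact ⟨mem_range_self x, (Function.leftInverse_invFun hinj x).symm⟩
  rw [this]
  exact isClosed_eq continuous_fst (hf.comp continuous_snd)

/-- By compactness the inverse is continuous on the range, so `mapsTo_cbDeriv` applies in both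
directions. -/
theorem cbDeriv_image [CompactSpace X] [T2Space X] [CompactSpace Y] [T2Space Y] [Nonempty X]
    {f : X → Y} (hf : Continuous f) (hinj : Function.Injective f) (A : Set X) (α : Ordinal.{0}) :
    cbDeriv (f '' A) α = f '' cbDeriv A α := by
  refine Subset.antisymm (fun y hy => ?_)
    (mapsTo_cbDeriv hf.continuousOn hinj.injOn (mapsTo_image f A) α).image_subset
  have hm : MapsTo (Function.invFun f) (f '' A) A := by
    rintro _ ⟨x, hx, rfl⟩
    rwa [Function.leftInverse_invFun hinj]
  have h := mapsTo_cbDeriv ((continuousOn_invFun hf hinj).mono (image_subset_range f A))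
    (fun y hy z hz h => by
      obtain ⟨a, -, rfl⟩ := hy
      obtain ⟨b, -, rfl⟩ := hz
      rw [Function.leftInverse_invFun hinj, Function.leftInverse_invFun hinj] at h
      rw [h]) hm α hy
  obtain ⟨x, -, rfl⟩ := cbDeriv_subset _ α hy
  rw [Function.leftInverse_invFun hinj] at h
  exact mem_image_of_mem f h

theorem cbDeriv_union {A B : Set X} (hA : IsClosed A) (hB : IsClosed B) (hd : Disjoint A B)
    (α : Ordinal.{0}) : cbDeriv (A ∪ B) α = cbDeriv A α ∪ cbDeriv B α := by
  refine Subset.antisymm (fun x hx => ?_)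
    (union_subset (cbDeriv_mono subset_union_left α) (cbDeriv_mono subset_union_right α))
  have key : ∀ {A B : Set X}, IsClosed B → Disjoint A B → x ∈ A → x ∈ cbDeriv (A ∪ B) α →
      x ∈ cbDeriv A α := by
    intro A B hB hd hxA hx
    refine cbDeriv_mono ?_ α (mem_cbDeriv_inter hB.isOpen_compl hx (disjoint_left.1 hd hxA))
    rintro y ⟨hy | hy, hyB⟩
    · exact hy
    · exact absurd hy hyB
  rcases cbDeriv_subset _ α hx with h | h
  · exact Or.inl (key hB hd h hx)
  · exact Or.inr (key hA hd.symm h (union_comm A B ▸ hx))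

end Transport

/-! ### Comparison of products and sums -/

namespace AS

instance : Nonempty ASet := ⟨∅⟩

theorem Embeds.ncard_cbDeriv_le {g : ASet → ASet} {A B : Set ASet} (h : Embeds g A B)
    {α : Ordinal.{0}} (hfin : (cbDeriv B α).Finite) :
    (cbDeriv A α).ncard ≤ (cbDeriv B α).ncard :=
  ncard_le_ncard_of_injOn g (mapsTo_cbDeriv h.continuousOn h.injOn h.mapsTo α)
    (h.injOn.mono (cbDeriv_subset A α)) hfin

theorem continuous_opair_right (c : ASet) : Continuous (opair c) :=
  continuous_opair.comp (continuous_const.prodMk continuous_id)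

theorem continuous_opair_left (c : ASet) : Continuous fun a => opair a c :=
  continuous_opair.comp (continuous_id.prodMk continuous_const)

theorem opair_right_injective (c : ASet) : Function.Injective (opair c) :=
  fun _ _ h => (opair_inj.1 h).2

theorem opair_left_injective (c : ASet) : Function.Injective fun a => opair a c :=
  fun _ _ h => (opair_inj.1 h).1

theorem pts_prod_single (c A : ASet) : (prod (single c) A).pts = opair c '' A.pts := by
  ext z
  rw [mem_pts, mem_prod_iff]
  constructor
  · rintro ⟨a, ha, b, hb, rfl⟩
    rw [mem_single.1 ha]
    exact mem_image_of_mem _ hb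
  · rintro ⟨b, hb, rfl⟩
    exact ⟨c, mem_single.2 rfl, b, hb, rfl⟩

theorem mem_nOrd_succ {n : ℕ} {x : ASet} : x ∈ nOrd (n + 1) ↔ x ∈ nOrd n ∨ x = nOrd n := by
  rw [nOrd, mem_union, mem_single]

theorem nOrd_subset_of_mem {m n : ℕ} (h : nOrd m ∈ nOrd n) : ∀ x ∈ nOrd m, x ∈ nOrd n := by
  induction n with
  | zero => exact absurd h (not_mem_empty _)
  | succ n ih =>
    intro x hx
    rcases mem_nOrd_succ.1 h with h | h
    · exact mem_nOrd_succ.2 (Or.inl (ih h x hx))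
    · exact mem_nOrd_succ.2 (Or.inl (h ▸ hx))

theorem nOrd_not_mem_self (n : ℕ) : nOrd n ∉ nOrd n := by
  induction n with
  | zero => exact not_mem_empty _
  | succ n ih =>
    intro h
    have hn : nOrd n ∈ nOrd (n + 1) := mem_nOrd_succ.2 (Or.inr rfl)
    rcases mem_nOrd_succ.1 h with h | h
    · exact ih (nOrd_subset_of_mem h _ hn)
    · exact ih (h ▸ hn)

theorem nOrd_one_ne_two : nOrd 1 ≠ nOrd 2 := fun h =>
  nOrd_not_mem_self 1 (by
    have : nOrd 1 ∈ nOrd 2 := mem_nOrd_succ.2 (Or.inr rfl)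
    rwa [← h] at this)

theorem disjoint_opair_image {c d : ASet} (h : c ≠ d) (A B : Set ASet) :
    Disjoint (opair c '' A) (opair d '' B) := by
  rw [disjoint_left]
  rintro _ ⟨a, -, rfl⟩ ⟨b, -, hb⟩
  exact h (opair_inj.1 hb).1.symm

theorem isClosed_opair_image (c : ASet) {A : Set ASet} (hA : IsClosed A) :
    IsClosed (opair c '' A) :=
  (hA.isCompact.image (continuous_opair_right c)).isClosed

theorem pts_prod_nOrd_succ (n : ℕ) (A : ASet) :
    (prod (nOrd (n + 1)) A).pts = (prod (nOrd n) A).pts ∪ opair (nOrd n) '' A.pts := by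
  rw [← pts_prod_single]
  ext z
  simp only [mem_pts, mem_prod_iff, Set.mem_union, mem_nOrd_succ, mem_single]
  grind

theorem disjoint_prod_nOrd (n : ℕ) (A : ASet) :
    Disjoint (prod (nOrd n) A).pts (opair (nOrd n) '' A.pts) := by
  rw [disjoint_left]
  rintro _ hz ⟨b, -, rfl⟩
  exact nOrd_not_mem_self n (opair_mem_prod.1 hz).1

theorem ncard_cbDeriv_prod_nOrd {A : ASet} {α : Ordinal.{0}} (hfin : (cbDeriv A.pts α).Finite)
    (n : ℕ) : (cbDeriv (prod (nOrd n) A).pts α).Finite ∧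
      (cbDeriv (prod (nOrd n) A).pts α).ncard = n * (cbDeriv A.pts α).ncard := by
  induction n with
  | zero =>
    have : cbDeriv (prod (nOrd 0) A).pts α = ∅ := by
      refine eq_empty_of_forall_notMem fun z hz => ?_
      obtain ⟨a, ha, -⟩ := mem_prod_iff.1 (cbDeriv_subset _ α hz)
      exact not_mem_empty a ha
    simp [this]
  | succ n ih =>
    have hdisj := disjoint_prod_nOrd n A
    rw [pts_prod_nOrd_succ, cbDeriv_union (isClosed_pts _) (isClosed_opair_image _ (isClosed_pts A))
      hdisj, cbDeriv_image (continuous_opair_right _) (opair_right_injective _)]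
    have hfin' := hfin.image (opair (nOrd n))
    refine ⟨ih.1.union hfin', ?_⟩
    rw [ncard_union_eq _ ih.1 hfin', ih.2, ncard_image_of_injective _ (opair_right_injective _)]
    · ring
    · exact hdisj.mono (cbDeriv_subset _ α) (image_mono (cbDeriv_subset _ α))

/-- For fixed `n`, points that are upward isolated by their `n`th neighbourhoods have distinct `n`th
approximations: of two sharing one, the smaller would have the larger in its neighbourhood. So there
are finitely many for each `n`. -/
theorem WellOrders.countable {R A : ASet} (h : WellOrders R A) : A.pts.Countable := by
  have : A.pts ⊆ ⋃ n : ℕ, {x ∈ A.pts | ∀ y ∈ A, InNhd n x y → ¬ Less R x y} := fun x hx => by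
    obtain ⟨n, hn⟩ := h.upward_isolated x hx
    exact mem_iUnion.2 ⟨n, hx, hn⟩
  refine Set.Countable.mono this (countable_iUnion fun n => Set.Finite.countable ?_)
  refine Set.Finite.of_injOn (f := fun x : ASet => x.approx n) (mapsTo_univ _ _) ?_ finite_univ
  rintro x ⟨hx, hx'⟩ y ⟨hy, hy'⟩ (heq : x.approx n = y.approx n)
  by_contra hne
  rcases h.total x hx y hy hne with hlt | hlt
  · exact hx' y hy heq.symm hlt
  · exact hy' x hx heq hlt

theorem WellOrderable.exists_cbRank {A : ASet} (h : WellOrderable A) (hne : A ≠ ∅) :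
    ∃ α : Ordinal.{0}, (cbDeriv A.pts α).Nonempty ∧ derivedSet (cbDeriv A.pts α) = ∅ :=
  _root_.exists_cbRank (isClosed_pts A) (ne_empty_iff.1 hne) (h.elim fun _ hR => hR.countable)

theorem finite_cbDeriv {A : ASet} {α : Ordinal.{0}} (h : derivedSet (cbDeriv A.pts α) = ∅) :
    (cbDeriv A.pts α).Finite :=
  finite_of_derivedSet_eq_empty (isClosed_cbDeriv (isClosed_pts A) α) h

theorem cardLT_of_not_cardLE {A B : ASet} (h : CardLE A B) (h' : ¬ CardLE B A) : CardLT A B :=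
  ⟨h, fun e => h' e.2⟩

theorem cardLE_of_subset {A B : ASet} (h : A.pts ⊆ B.pts) : CardLE A B :=
  cardLE_iff.2 ⟨id, continuousOn_id, injOn_id _, h⟩

theorem WellOrderable.prod_nOrd_cardLT {A : ASet} (hA : WellOrderable A) (hne : A ≠ ∅) (n : ℕ) :
    CardLT (prod (nOrd n) A) (prod (nOrd (n + 1)) A) := by
  obtain ⟨α, hα, hα'⟩ := hA.exists_cbRank hne
  have hfin := finite_cbDeriv hα'
  refine cardLT_of_not_cardLE (cardLE_of_subset ?_) fun hle => ?_
  · rw [pts_prod_nOrd_succ]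
    exact subset_union_left
  · obtain ⟨g, hg⟩ := cardLE_iff.1 hle
    have h1 := ncard_cbDeriv_prod_nOrd hfin n
    have h2 := ncard_cbDeriv_prod_nOrd hfin (n + 1)
    have h3 := hg.ncard_cbDeriv_le h1.1
    rw [h1.2, h2.2] at h3
    have h4 := (ncard_pos hfin).2 hα
    nlinarith

theorem pts_sum (A₁ A₂ : ASet) :
    (sum A₁ A₂).pts = opair (nOrd 1) '' A₁.pts ∪ opair (nOrd 2) '' A₂.pts := by
  rw [← pts_prod_single, ← pts_prod_single]
  exact ext fun _ => mem_union

theorem cbDeriv_sum (A₁ A₂ : ASet) (α : Ordinal.{0}) : cbDeriv (sum A₁ A₂).pts α =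
    opair (nOrd 1) '' cbDeriv A₁.pts α ∪ opair (nOrd 2) '' cbDeriv A₂.pts α := by
  rw [pts_sum, cbDeriv_union (isClosed_opair_image _ (isClosed_pts A₁))
    (isClosed_opair_image _ (isClosed_pts A₂)) (disjoint_opair_image nOrd_one_ne_two _ _),
    cbDeriv_image (continuous_opair_right _) (opair_right_injective _),
    cbDeriv_image (continuous_opair_right _) (opair_right_injective _)]

theorem Embeds.opair_image {g : ASet → ASet} {A B : Set ASet} (hg : Embeds g A B) (c : ASet) :
    Embeds (g ∘ Function.invFun (opair c)) (opair c '' A) B := by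
  have hinv : ∀ a, Function.invFun (opair c) (opair c a) = a :=
    Function.leftInverse_invFun (opair_right_injective c)
  refine hg.comp ⟨(continuousOn_invFun (continuous_opair_right c) (opair_right_injective c)).mono
    (image_subset_range _ _), ?_, ?_⟩
  · rintro _ ⟨a, -, rfl⟩ _ ⟨b, -, rfl⟩ h
    rw [hinv, hinv] at h
    rw [h]
  · rintro _ ⟨a, ha, rfl⟩
    rwa [hinv]

theorem sum_cardLE {A₁ A₂ B : ASet} {f g : ASet → ASet} (hf : Embeds f A₁.pts B.pts)
    (hg : Embeds g A₂.pts B.pts) (hne : ∀ x ∈ A₁, ∀ y ∈ A₂, f x ≠ g y) :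
    CardLE (sum A₁ A₂) B := by
  rw [cardLE_iff, pts_sum]
  refine (hf.opair_image (nOrd 1)).exists_union (hg.opair_image (nOrd 2))
    (isClosed_opair_image _ (isClosed_pts A₁)) (isClosed_opair_image _ (isClosed_pts A₂))
    (disjoint_opair_image nOrd_one_ne_two _ _) ?_
  rintro _ ⟨a, ha, rfl⟩ _ ⟨b, hb, rfl⟩
  simp only [Function.comp_apply, Function.leftInverse_invFun (opair_right_injective _) _]
  exact hne a ha b hb

theorem cardLE_sum_right (A₁ A₂ : ASet) : CardLE A₂ (sum A₁ A₂) :=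
  cardLE_iff.2 ⟨opair (nOrd 2), (continuous_opair_right _).continuousOn,
    (opair_right_injective _).injOn, fun x hx => by
      rw [pts_sum]
      exact Or.inr (mem_image_of_mem _ hx)⟩

theorem IsInfinite.exists_embeds {A : ASet} (h : IsInfinite A) :
    ∃ g, Embeds g A.pts A.pts ∧ ∃ p ∈ A, ∀ x ∈ A, g x ≠ p := by
  obtain ⟨B, hBA, hne, f, hf⟩ := h
  obtain ⟨g, hg, -⟩ := hf.toIsInjection.exists_embeds
  have : ∃ p ∈ A, p ∉ B := by
    by_contra! hp
    exact hne (aset_ext fun x => ⟨hBA x, hp x⟩)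
  obtain ⟨p, hp, hpB⟩ := this
  exact ⟨g, hg.mono le_rfl hBA, p, hp, fun x hx hxp => hpB (hxp ▸ hg.mapsTo hx)⟩

/-- Without accumulation points a closed set is finite, and the pigeonhole principle excludes an
injection into a proper subset. -/
theorem IsInfinite.exists_mem_derivedSet {A : ASet} (h : IsInfinite A) :
    (derivedSet A.pts).Nonempty := by
  obtain ⟨g, hg, p, hp, hgp⟩ := h.exists_embeds
  rw [nonempty_iff_ne_empty]
  intro hemp
  have hfin := finite_of_derivedSet_eq_empty (isClosed_pts A) hemp
  have himg : g '' A.pts = A.pts :=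
    eq_of_subset_of_ncard_le hg.mapsTo.image_subset (InjOn.ncard_image hg.injOn).ge hfin
  obtain ⟨x, hx, hxp⟩ := himg.ge hp
  exact hgp x hx hxp

/-- Send `A₁` to the line `A₁ × {p}` and `A₂` to `{q} × A₂`. Shifting `A₂` by an injection that
misses `p` avoids the crossing point. -/
theorem sum_cardLE_prod {A₁ A₂ : ASet} (h₁ : IsInfinite A₁) (h₂ : IsInfinite A₂) :
    CardLE (sum A₁ A₂) (prod A₁ A₂) := by
  obtain ⟨-, -, q, hq, -⟩ := h₁.exists_embeds
  obtain ⟨g, hg, p, hp, hgp⟩ := h₂.exists_embeds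
  refine sum_cardLE (f := fun a => opair a p) (g := opair q ∘ g)
    ⟨(continuous_opair_left p).continuousOn, (opair_left_injective p).injOn,
      fun a ha => opair_mem_prod.2 ⟨ha, hp⟩⟩
    ⟨(continuous_opair_right q).comp_continuousOn hg.continuousOn,
      fun x hx y hy h => hg.injOn hx hy (opair_right_injective q h),
      fun b hb => opair_mem_prod.2 ⟨hq, hg.mapsTo hb⟩⟩ ?_
  intro a _ b hb h
  exact hgp b hb (opair_inj.1 h).2.symm

theorem not_prod_cardLE_sum {A₁ A₂ : ASet} (h₁ : IsInfinite A₁) (h₂ : IsInfinite A₂)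
    (hw₁ : WellOrderable A₁) (hw₂ : WellOrderable A₂) : ¬ CardLE (prod A₁ A₂) (sum A₁ A₂) := by
  obtain ⟨a, ha⟩ := h₁.exists_mem_derivedSet
  obtain ⟨b, hb⟩ := h₂.exists_mem_derivedSet
  have hA₁ : A₁ ≠ ∅ :=
    ne_empty_iff.2 ⟨a, derivedSet_subset_of_isClosed (isClosed_pts A₁) le_rfl ha⟩
  have hA₂ : A₂ ≠ ∅ :=
    ne_empty_iff.2 ⟨b, derivedSet_subset_of_isClosed (isClosed_pts A₂) le_rfl hb⟩
  obtain ⟨α₁, ⟨x₁, hx₁⟩, hd₁⟩ := hw₁.exists_cbRank hA₁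
  obtain ⟨α₂, ⟨x₂, hx₂⟩, hd₂⟩ := hw₂.exists_cbRank hA₂
  intro hle
  obtain ⟨g, hg⟩ := cardLE_iff.1 hle
  have hempty : ∀ {A : ASet} {α β : Ordinal.{0}}, derivedSet (cbDeriv A.pts α) = ∅ → α ≤ β →
      cbDeriv A.pts (β + 1) = ∅ := by
    intro A α β hd hαβ
    rw [cbDeriv_add_one (isClosed_pts A)]
    exact subset_empty_iff.1 (hd ▸ derivedSet_mono _ _ (cbDeriv_antitone _ hαβ))
  have hsum : ∀ β, α₁ ≤ β → α₂ ≤ β → cbDeriv (prod A₁ A₂).pts (β + 1) = ∅ := by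
    intro β h h'
    refine eq_empty_of_forall_notMem fun z hz => ?_
    have := mapsTo_cbDeriv hg.continuousOn hg.injOn hg.mapsTo (β + 1) hz
    rw [cbDeriv_sum, hempty hd₁ h, hempty hd₂ h'] at this
    simp at this
  -- If `b` is in the `β`th derivative of one factor, then so is `f x b` in that of the product for
  -- every `x ∈ A`. These points accumulate at `f a b`, which raises the index by one. The map `f`
  -- allows either order of the factors.
  have key : ∀ {A B : ASet} {f : ASet → ASet → ASet} {β : Ordinal.{0}} {a b : ASet},
      (∀ x, Continuous (f x)) → (∀ x, Function.Injective (f x)) →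
      (∀ y, Continuous (f · y)) → (∀ y, Function.Injective (f · y)) →
      (∀ x ∈ A, ∀ y ∈ B, f x y ∈ prod A₁ A₂) → a ∈ derivedSet A.pts → b ∈ cbDeriv B.pts β →
      f a b ∈ cbDeriv (prod A₁ A₂).pts (β + 1) := by
    intro A B f β a b h1 h2 h3 h4 hm ha hb
    rw [cbDeriv_add_one (isClosed_pts _)]
    refine derivedSet_mono ((f · b) '' A.pts) _ ?_
      ((h3 b).image_derivedSet (h4 b) (mem_image_of_mem _ ha))
    rintro _ ⟨x, hx, rfl⟩
    exact mapsTo_cbDeriv (h1 x).continuousOn (h2 x).injOn (fun y hy => hm x hx y hy) β hb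
  rcases le_total α₁ α₂ with h | h
  · have := key (f := opair) continuous_opair_right opair_right_injective continuous_opair_left
      opair_left_injective (fun x hx y hy => opair_mem_prod.2 ⟨hx, hy⟩) ha hx₂
    rw [hsum α₂ h le_rfl] at this
    exact this
  · have := key (f := fun x y => opair y x) continuous_opair_left opair_left_injective
      continuous_opair_right opair_right_injective
      (fun x hx y hy => opair_mem_prod.2 ⟨hy, hx⟩) hb hx₁
    rw [hsum α₁ le_rfl h] at this
    exact this

theorem not_sum_cardLE_right {A₁ A₂ : ASet} {α : Ordinal.{0}} (h₁ : (cbDeriv A₁.pts α).Nonempty)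
    (hd₁ : derivedSet (cbDeriv A₁.pts α) = ∅) (hd₂ : derivedSet (cbDeriv A₂.pts α) = ∅) :
    ¬ CardLE (sum A₁ A₂) A₂ := by
  intro hle
  obtain ⟨g, hg⟩ := cardLE_iff.1 hle
  have hf₁ := finite_cbDeriv hd₁
  have hf₂ := finite_cbDeriv hd₂
  have h := hg.ncard_cbDeriv_le hf₂
  rw [cbDeriv_sum, ncard_union_eq (disjoint_opair_image nOrd_one_ne_two _ _) (hf₁.image _)
    (hf₂.image _), ncard_image_of_injective _ (opair_right_injective _),
    ncard_image_of_injective _ (opair_right_injective _)] at h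
  have := (ncard_pos hf₁).2 h₁
  omega

/-- A neighbourhood `U` isolating one point `y` of the last derivative of `A₂` absorbs both itself
and `A₁`; the rest of `A₂` stays fixed. -/
theorem sum_cardLE_right {A₁ A₂ : ASet} {α : Ordinal.{0}} (h₁ : cbDeriv A₁.pts α = ∅)
    (h₂ : (cbDeriv A₂.pts α).Nonempty) (hd₂ : derivedSet (cbDeriv A₂.pts α) = ∅) :
    CardLE (sum A₁ A₂) A₂ := by
  obtain ⟨y, hy⟩ := h₂
  have hyd : y ∉ derivedSet (cbDeriv A₂.pts α) := by simp [hd₂]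
  rw [mem_derivedSet_iff] at hyd
  push Not at hyd
  obtain ⟨n, hn⟩ := hyd
  set U := nhdIn A₂.pts n y with hU
  have hUcl : IsClosed U := isClosed_sep_inNhd (isClosed_pts A₂) n y
  have hVcl : IsClosed (A₂.pts \ U) := by
    have : A₂.pts \ U = A₂.pts ∩ {z | InNhd n y z}ᶜ := by
      ext z
      simp only [hU, nhdIn, Set.mem_sdiff, mem_inter_iff, mem_compl_iff, mem_ofPred_eq]
      tauto
    rw [this]
    exact (isClosed_pts A₂).inter (isClopen_inNhd n y).compl.isClosed
  have hUd : cbDeriv U α ⊆ {y} := fun z hz => by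
    by_contra hne
    exact hn z (cbDeriv_mono (sep_subset _ _) α hz) hne (cbDeriv_subset U α hz).2
  have hyU : y ∈ cbDeriv U α :=
    mem_cbDeriv_inter (isClopen_inNhd n y).isOpen hy (inNhd_refl n y)
  have hcl₁ := isClosed_opair_image (nOrd 1) (isClosed_pts A₁)
  have hcl₂ := isClosed_opair_image (nOrd 2) hUcl
  have hX : cbDeriv (opair (nOrd 1) '' A₁.pts ∪ opair (nOrd 2) '' U) α ⊆ {opair (nOrd 2) y} := by
    rw [cbDeriv_union hcl₁ hcl₂ (disjoint_opair_image nOrd_one_ne_two _ _),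
      cbDeriv_image (continuous_opair_right _) (opair_right_injective _),
      cbDeriv_image (continuous_opair_right _) (opair_right_injective _), h₁]
    simpa using image_mono hUd
  obtain ⟨f, hf, -⟩ := pointedAbsorption α _ _ (hcl₁.union hcl₂) hX U y hyU n
  have hfU : Embeds f (opair (nOrd 1) '' A₁.pts ∪ opair (nOrd 2) '' U) U :=
    hf.mono le_rfl (sep_subset _ _)
  have hid : Embeds id (A₂.pts \ U) (A₂.pts \ U) := ⟨continuousOn_id, injOn_id _, mapsTo_id _⟩
  have hg := hid.opair_image (nOrd 2)
  have hUA : U ⊆ A₂.pts := sep_subset _ _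
  obtain ⟨k, hk⟩ := (hfU.mono le_rfl hUA).exists_union (hg.mono le_rfl sdiff_subset)
    (hcl₁.union hcl₂) (isClosed_opair_image _ hVcl)
    (disjoint_union_left.2 ⟨disjoint_opair_image nOrd_one_ne_two _ _,
      (disjoint_image_iff (opair_right_injective _)).2 disjoint_sdiff_right⟩)
    (fun x hx z hz h => (hg.mapsTo hz).2 (h ▸ hfU.mapsTo hx))
  refine cardLE_iff.2 ⟨k, hk.mono ?_ le_rfl⟩
  rw [pts_sum, union_assoc, ← image_union, union_sdiff_cancel hUA]

end AS

/-! ### Order types of the ordinals of the universe -/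

namespace AS

theorem less_restrict {α : RelSet} {S x y : ASet} :
    Less (α.restrict S).rel x y ↔ Less α.rel x y ∧ x ∈ S ∧ y ∈ S := by
  simp only [Less, RelSet.restrict, mem_inter, opair_mem_prod]
  tauto

theorem IsOrdinal.restrict {α : RelSet} {S : ASet} (h : IsOrdinal α) (hS : S ⊆ α.carrier) :
    IsOrdinal (α.restrict S) where
  subset := fun _ hx => (mem_inter.1 hx).2
  asymm := fun x hx y hy hxy hyx =>
    h.asymm x (hS x hx) y (hS y hy) (less_restrict.1 hxy).1 (less_restrict.1 hyx).1
  trans := fun x hx y hy z hz hxy hyz => less_restrict.2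
    ⟨h.trans x (hS x hx) y (hS y hy) z (hS z hz) (less_restrict.1 hxy).1 (less_restrict.1 hyz).1,
      hx, hz⟩
  total := fun x hx y hy hne =>
    (h.total x (hS x hx) y (hS y hy) hne).imp (fun hl => less_restrict.2 ⟨hl, hx, hy⟩)
      fun hl => less_restrict.2 ⟨hl, hy, hx⟩
  exists_min := fun T hT hne => by
    obtain ⟨m, hm, hmin⟩ := h.exists_min T (fun x hx => hS x (hT x hx)) hne
    exact ⟨m, hm, fun x hx hxm => less_restrict.2 ⟨hmin x hx hxm, hT m hm, hT x hx⟩⟩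
  upward_isolated := fun x hx => by
    obtain ⟨n, hn⟩ := h.upward_isolated x (hS x hx)
    exact ⟨n, fun y hy hxy hl => hn y (hS y hy) hxy (less_restrict.1 hl).1⟩

theorem less_irrefl (R x : ASet) : ¬ Less R x x := fun h => h.1 rfl

/-- In an ordinal not only closed sets of elements have a minimal element. -/
theorem IsOrdinal.exists_min_set {α : RelSet} (h : IsOrdinal α) {S : Set ASet}
    (hS : S ⊆ α.carrier.pts) (hne : S.Nonempty) : ∃ m ∈ S, ∀ x ∈ S, x ≠ m → Less α.rel m x := by
  have hsub : hull (· ∈ S) ⊆ α.carrier := fun x hx =>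
    closure_minimal hS (isClosed_pts _) (mem_hull_iff.1 hx)
  have hmem : ∀ x ∈ S, x ∈ hull (· ∈ S) := fun x hx => mem_hull_iff.2 (subset_closure hx)
  obtain ⟨x, hx⟩ := hne
  obtain ⟨m, hm, hmin⟩ := h.exists_min _ hsub (ne_empty_iff.2 ⟨x, hmem x hx⟩)
  refine ⟨m, ?_, fun x hx => hmin x (hmem x hx)⟩
  -- The minimum of the closure lies in `S`: otherwise points of `S`, all above `m`, would approach
  -- `m`, against upward isolation.
  obtain ⟨n, hn⟩ := h.upward_isolated m (hsub m hm)
  obtain ⟨y, hy, hmy⟩ := mem_closure_iff_inNhd.1 (mem_hull_iff.1 hm) n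
  by_contra hmS
  have hne : y ≠ m := fun h => hmS (h ▸ hy)
  exact hn y (hS hy) hmy (hmin y (hmem y hy) hne)

/-- The upper segments are nonempty, compact and directed by inclusion, so they have a common point.
-/
theorem IsOrdinal.exists_max {α : RelSet} (h : IsOrdinal α) (hne : α.carrier ≠ ∅) :
    ∃ m, IsMax α.rel α.carrier m := by
  obtain ⟨x₀, hx₀⟩ := ne_empty_iff.1 hne
  let t : α.carrier.pts → Set ASet := fun x => {y ∈ α.carrier.pts | y = x ∨ opair x y ∈ α.rel}
  have hcl : ∀ x, IsClosed (t x) := fun x =>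
    (isClosed_pts α.carrier).inter (isClosed_singleton.union
      ((isClosed_pts α.rel).preimage (continuous_opair_right x)))
  have hless : ∀ (x y : ASet) (hy : y ∈ α.carrier) (hx : x ∈ α.carrier), Less α.rel x y →
      t ⟨y, hy⟩ ⊆ t ⟨x, hx⟩ := by
    rintro x y hy hx hxy z ⟨hz, rfl | hyz⟩
    · exact ⟨hz, Or.inr hxy.2⟩
    · refine ⟨hz, ?_⟩
      by_cases hyz' : y = z
      · subst hyz'
        exact Or.inr hxy.2
      · exact Or.inr (h.trans x hx y hy z hz hxy ⟨hyz', hyz⟩).2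
  have : Nonempty α.carrier.pts := ⟨⟨x₀, hx₀⟩⟩
  obtain ⟨m, hm⟩ := IsCompact.nonempty_iInter_of_directed_nonempty_isCompact_isClosed t
    (fun x y => by
      by_cases hxy : x = y
      · exact ⟨x, le_rfl, hxy ▸ le_rfl⟩
      · rcases h.total x x.2 y y.2 (fun h => hxy (Subtype.ext h)) with hl | hl
        · exact ⟨y, hless x y y.2 x.2 hl, le_rfl⟩
        · exact ⟨x, le_rfl, hless y x x.2 y.2 hl⟩)
    (fun x => ⟨x, x.2, Or.inl rfl⟩) (fun x => (hcl x).isCompact) hcl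
  rw [mem_iInter] at hm
  refine ⟨m, (hm ⟨x₀, hx₀⟩).1, fun x hx hxm => ⟨hxm, ?_⟩⟩
  exact (hm ⟨x, hx⟩).2.resolve_left fun h => hxm h.symm

/-- The strict ordering of the elements of an ordinal. -/
def RelSet.lt (α : RelSet) (x y : {x // x ∈ α.carrier}) : Prop := Less α.rel x y

theorem IsOrdinal.isWellOrder {α : RelSet} (h : IsOrdinal α) :
    IsWellOrder {x // x ∈ α.carrier} α.lt where
  wf := by
    rw [WellFounded.wellFounded_iff_has_min]
    intro S hS
    obtain ⟨m, ⟨m', hm', rfl⟩, hmin⟩ := h.exists_min_set (S := Subtype.val '' S)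
      (by rintro _ ⟨x, -, rfl⟩; exact x.2) (hS.image _)
    refine ⟨m', hm', fun x hx hlt => ?_⟩
    exact h.asymm _ x.2 _ m'.2 hlt (hmin x (mem_image_of_mem _ hx) hlt.1)
  trichotomous := fun x y hxy hyx => by
    by_contra hne
    rcases h.total x x.2 y y.2 (fun h => hne (Subtype.ext h)) with hl | hl
    · exact hxy hl
    · exact hyx hl

open Classical in
/-- The order type of an ordinal of the universe. -/
noncomputable def RelSet.typ (α : RelSet) : Ordinal.{0} :=
  if h : IsOrdinal α then @Ordinal.type _ α.lt h.isWellOrder else 0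

open Classical in
/-- The order type of the set of elements of `α` below `x`. -/
noncomputable def RelSet.pos (α : RelSet) (x : ASet) : Ordinal.{0} :=
  if h : IsOrdinal α ∧ x ∈ α.carrier then @Ordinal.typein _ α.lt h.1.isWellOrder ⟨x, h.2⟩ else 0

section

variable {α β : RelSet}

theorem IsOrdinal.pos_lt_pos (h : IsOrdinal α) {x y : ASet} (hx : x ∈ α.carrier)
    (hy : y ∈ α.carrier) : α.pos x < α.pos y ↔ Less α.rel x y := by
  have := h.isWellOrder
  rw [RelSet.pos, RelSet.pos, dif_pos ⟨h, hx⟩, dif_pos ⟨h, hy⟩]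
  exact Ordinal.typein_lt_typein α.lt

theorem IsOrdinal.pos_lt_typ (h : IsOrdinal α) {x : ASet} (hx : x ∈ α.carrier) :
    α.pos x < α.typ := by
  have := h.isWellOrder
  rw [RelSet.pos, RelSet.typ, dif_pos ⟨h, hx⟩, dif_pos h]
  exact Ordinal.typein_lt_type α.lt _

theorem IsOrdinal.exists_pos_eq (h : IsOrdinal α) {o : Ordinal.{0}} (ho : o < α.typ) :
    ∃ x ∈ α.carrier, α.pos x = o := by
  have := h.isWellOrder
  rw [RelSet.typ, dif_pos h] at ho
  obtain ⟨x, hx⟩ := Ordinal.typein_surj α.lt ho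
  exact ⟨x, x.2, by rw [RelSet.pos, dif_pos ⟨h, x.2⟩]; exact hx⟩

/-- `g` maps `α` isomorphically to an initial segment of `β`. -/
structure InitialMap (g : ASet → ASet) (α β : RelSet) : Prop where
  mapsTo : ∀ x ∈ α.carrier, g x ∈ β.carrier
  map_less : ∀ x ∈ α.carrier, ∀ y ∈ α.carrier, Less α.rel x y → Less β.rel (g x) (g y)
  exists_eq : ∀ x ∈ α.carrier, ∀ y ∈ β.carrier, Less β.rel y (g x) → ∃ z ∈ α.carrier, g z = y

theorem InitialMap.pos_eq {g : ASet → ASet} (hg : InitialMap g α β) (hα : IsOrdinal α)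
    (hβ : IsOrdinal β) {x : ASet} (hx : x ∈ α.carrier) : β.pos (g x) = α.pos x := by
  have := hα.isWellOrder
  have := hβ.isWellOrder
  let f : α.lt ↪r β.lt := RelEmbedding.ofMonotone (fun x => ⟨g x, hg.mapsTo x x.2⟩)
    fun x y hxy => hg.map_less x x.2 y y.2 hxy
  let i : InitialSeg α.lt β.lt := ⟨f, fun x y hy => by
    obtain ⟨z, hz, hzy⟩ := hg.exists_eq x x.2 y y.2 hy
    exact ⟨⟨z, hz⟩, Subtype.ext hzy⟩⟩
  rw [RelSet.pos, RelSet.pos, dif_pos ⟨hβ, hg.mapsTo x hx⟩, dif_pos ⟨hα, hx⟩]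
  exact Ordinal.typein_apply i ⟨x, hx⟩

theorem InitialMap.typ_le {g : ASet → ASet} (hg : InitialMap g α β) (hα : IsOrdinal α)
    (hβ : IsOrdinal β) : α.typ ≤ β.typ := by
  refine le_of_forall_lt fun o ho => ?_
  obtain ⟨x, hx, rfl⟩ := hα.exists_pos_eq ho
  rw [← hg.pos_eq hα hβ hx]
  exact hβ.pos_lt_typ (hg.mapsTo x hx)

/-- The image is downward closed, so if it misses `b` it lies entirely below `b`. -/
theorem InitialMap.typ_le_pos {g : ASet → ASet} (hg : InitialMap g α β) (hα : IsOrdinal α)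
    (hβ : IsOrdinal β) {b : ASet} (hb : b ∈ β.carrier) (hn : ∀ x ∈ α.carrier, g x ≠ b) :
    α.typ ≤ β.pos b := by
  refine le_of_forall_lt fun o ho => ?_
  obtain ⟨x, hx, rfl⟩ := hα.exists_pos_eq ho
  have hgx := hg.mapsTo x hx
  rw [← hg.pos_eq hα hβ hx, hβ.pos_lt_pos hgx hb]
  refine (hβ.total _ hgx b hb (hn x hx)).resolve_right fun hl => ?_
  obtain ⟨z, hz, hzb⟩ := hg.exists_eq x hx b hb hl
  exact hn z hz hzb

theorem initialMap_of_isIso {f S : ASet} (hS : IsInitialSegment S β)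
    (hf : IsIso f α (β.restrict S)) :
    ∃ g, InitialMap g α β ∧ ∀ x ∈ α.carrier, g x ∈ S := by
  obtain ⟨g, hg, hgf⟩ := hf.toIsInjection.exists_embeds
  refine ⟨g, ⟨fun x hx => hS.1 _ (hg.mapsTo hx), fun x hx y hy hxy => ?_, fun x hx y hy hl => ?_⟩,
    fun x hx => hg.mapsTo hx⟩
  · exact (less_restrict.1 (hf.map_less x y _ _ (hgf x hx) (hgf y hy) hxy)).1
  · obtain ⟨z, hz, hzy⟩ := hf.surjective y (hS.2 _ (hg.mapsTo hx) y hy hl)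
    exact ⟨z, hz, hf.functional _ _ _ (hgf z hz) hzy⟩

theorem OrdLE.typ_le (h : OrdLE α β) (hα : IsOrdinal α) (hβ : IsOrdinal β) : α.typ ≤ β.typ := by
  obtain ⟨S, hS, f, hf⟩ := h
  obtain ⟨g, hg, -⟩ := initialMap_of_isIso hS hf
  exact hg.typ_le hα hβ

theorem OrdEq.typ_eq (h : OrdEq α β) (hα : IsOrdinal α) (hβ : IsOrdinal β) : α.typ = β.typ :=
  (h.1.typ_le hα hβ).antisymm (h.2.typ_le hβ hα)

theorem OrdLT.typ_lt (h : OrdLT α β) (hα : IsOrdinal α) (hβ : IsOrdinal β) : α.typ < β.typ := by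
  obtain ⟨S, hS, hne, f, hf⟩ := h
  obtain ⟨g, hg, hgS⟩ := initialMap_of_isIso hS hf
  obtain ⟨b, hb, hbS⟩ : ∃ b ∈ β.carrier, b ∉ S := by
    by_contra! hb
    exact hne (aset_ext fun x => ⟨hS.1 x, hb x⟩)
  exact (hg.typ_le_pos hα hβ hb fun x hx h => hbS (h ▸ hgS x hx)).trans_lt (hβ.pos_lt_typ hb)

theorem initialMap_restrict {S : ASet} (hS : IsInitialSegment S α) :
    InitialMap id (α.restrict S) α :=
  ⟨hS.1, fun _ _ _ _ h => (less_restrict.1 h).1, fun x hx y hy hl => ⟨y, hS.2 x hx y hy hl, rfl⟩⟩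

theorem exists_isIso_self (α : RelSet) : ∃ f, IsIso f α α := by
  have hcl : IsClosed {z | ∃ a ∈ α.carrier, z = opair a a} := by
    have : {z | ∃ a ∈ α.carrier, z = opair a a} = (fun a => opair a a) '' α.carrier.pts := by
      ext z
      simp [eq_comm]
    rw [this]
    exact ((isClosed_pts _).isCompact.image
      (continuous_opair.comp (continuous_id.prodMk continuous_id))).isClosed
  have hmem : ∀ a b, opair a b ∈ hull (fun z => ∃ a ∈ α.carrier, z = opair a a) ↔
      a ∈ α.carrier ∧ b = a := fun a b => by
    rw [mem_hull_of_isClosed hcl]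
    constructor
    · rintro ⟨c, hc, h⟩
      obtain ⟨rfl, rfl⟩ := opair_inj.1 h
      exact ⟨hc, rfl⟩
    · rintro ⟨ha, rfl⟩
      exact ⟨b, ha, rfl⟩
  refine ⟨hull fun z => ∃ a ∈ α.carrier, z = opair a a,
    ⟨⟨⟨?_, fun a ha => ⟨a, ha, (hmem _ _).2 ⟨ha, rfl⟩⟩, ?_, ?_⟩,
      fun a ha => ⟨a, ha, (hmem _ _).2 ⟨ha, rfl⟩⟩⟩, ?_⟩⟩
  · intro z hz
    obtain ⟨a, ha, rfl⟩ := (mem_hull_of_isClosed hcl).1 hz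
    exact opair_mem_prod.2 ⟨ha, ha⟩
  · intro a b b' h h'
    rw [((hmem _ _).1 h).2, ((hmem _ _).1 h').2]
  · intro a a' b h h'
    rw [← ((hmem _ _).1 h).2, ((hmem _ _).1 h').2]
  · intro x₁ x₂ y₁ y₂ h₁ h₂ hl
    rwa [((hmem _ _).1 h₁).2, ((hmem _ _).1 h₂).2]

theorem ordLT_restrict {S : ASet} (hS : IsInitialSegment S α) (hne : S ≠ α.carrier) :
    OrdLT (α.restrict S) α :=
  ⟨S, hS, hne, exists_isIso_self _⟩

theorem ordLE_refl (α : RelSet) : OrdLE α α := by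
  refine ⟨α.carrier, ⟨fun _ h => h, fun _ _ _ h _ => h⟩, ?_⟩
  obtain ⟨f, hf⟩ := exists_isIso_self α
  exact ⟨f, hf.toIsBijection, fun x₁ x₂ y₁ y₂ h₁ h₂ hl => less_restrict.2
    ⟨hf.map_less x₁ x₂ y₁ y₂ h₁ h₂ hl, (opair_mem_prod.1 (hf.subset _ h₁)).2,
      (opair_mem_prod.1 (hf.subset _ h₂)).2⟩⟩

theorem ordEq_refl (α : RelSet) : OrdEq α α := ⟨ordLE_refl α, ordLE_refl α⟩

theorem IsOrdinal.typ_restrict (hα : IsOrdinal α) {S b : ASet} (hb : b ∈ α.carrier)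
    (hS : ∀ x, x ∈ S ↔ x ∈ α.carrier ∧ Less α.rel x b) : (α.restrict S).typ = α.pos b := by
  have hini : IsInitialSegment S α := ⟨fun x hx => ((hS x).1 hx).1, fun x hx y hy hl => (hS y).2
    ⟨hy, hα.trans y hy x ((hS x).1 hx).1 b hb hl ((hS x).1 hx).2⟩⟩
  have hord := hα.restrict hini.1
  refine ((initialMap_restrict hini).typ_le_pos hord hα hb ?_).antisymm
    (le_of_forall_lt fun o ho => ?_)
  · intro x hx h
    exact less_irrefl α.rel b (h ▸ ((hS x).1 hx).2)
  · obtain ⟨y, hy, rfl⟩ := hα.exists_pos_eq (ho.trans (hα.pos_lt_typ hb))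
    have hyS : y ∈ (α.restrict S).carrier := (hS y).2 ⟨hy, (hα.pos_lt_pos hy hb).1 ho⟩
    have := (initialMap_restrict hini).pos_eq hord hα hyS
    rw [id] at this
    rw [this]
    exact hord.pos_lt_typ hyS

theorem isClosed_setOf_le (α : RelSet) (b : ASet) :
    IsClosed {x ∈ α.carrier.pts | x = b ∨ Less α.rel x b} := by
  have : {x ∈ α.carrier.pts | x = b ∨ Less α.rel x b} =
      α.carrier.pts ∩ ({b} ∪ {x | opair x b ∈ α.rel}) := by
    ext x
    simp only [Less, mem_ofPred_eq, mem_inter_iff, Set.mem_union, mem_singleton_iff]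
    tauto
  rw [this]
  exact (isClosed_pts _).inter (isClosed_singleton.union
    ((isClosed_pts α.rel).preimage (continuous_opair_left b)))

end

theorem isOrdinal_empty : IsOrdinal ⟨∅, ∅⟩ where
  subset := fun x hx => absurd hx (not_mem_empty x)
  asymm := fun x hx => absurd hx (not_mem_empty x)
  trans := fun x hx => absurd hx (not_mem_empty x)
  total := fun x hx => absurd hx (not_mem_empty x)
  exists_min := fun S hS hne => by
    obtain ⟨x, hx⟩ := ne_empty_iff.1 hne
    exact absurd (hS x hx) (not_mem_empty x)
  upward_isolated := fun x hx => absurd hx (not_mem_empty x)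

theorem typ_eq_zero {α : RelSet} (h : α.carrier = ∅) : α.typ = 0 := by
  by_contra h0
  by_cases hα : IsOrdinal α
  · obtain ⟨x, hx, -⟩ := hα.exists_pos_eq (pos_iff_ne_zero.2 h0)
    exact not_mem_empty x (h ▸ hx)
  · exact h0 (dif_neg hα)

/-- The index ranks all pairs of a set and a relation. Those that are not ordinals have the default
type `0`, which the empty ordinal also has, so they do not affect it. -/
theorem exists_isOrdinal_typ_eq (α : RelSet) : ∃ β, IsOrdinal β ∧ β.typ = α.typ := by
  by_cases hα : IsOrdinal α
  · exact ⟨α, hα, rfl⟩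
  · exact ⟨⟨∅, ∅⟩, isOrdinal_empty, by rw [typ_eq_zero rfl, RelSet.typ, dif_neg hα]⟩

/-! ### Indices of ordinals, iterated derived sets and rank -/

/-- The index of an ordinal of the universe among all of them. As limits are followed by their
supremum, this is not the order type. -/
noncomputable def RelSet.idx (α : RelSet) : Ordinal.{0} :=
  IsWellFounded.rank (InvImage (· < ·) RelSet.typ) α

theorem lt_idx_iff {α : RelSet} {o : Ordinal.{0}} :
    o < α.idx ↔ ∃ β : RelSet, β.typ < α.typ ∧ o ≤ β.idx := by
  rw [RelSet.idx, IsWellFounded.rank_eq, Ordinal.lt_iSup_iff]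
  simp only [Order.lt_succ_iff, Subtype.exists, InvImage]
  exact ⟨fun ⟨β, h, h'⟩ => ⟨β, h, h'⟩, fun ⟨β, h, h'⟩ => ⟨β, h, h'⟩⟩

theorem idx_lt_idx {α β : RelSet} (h : α.typ < β.typ) : α.idx < β.idx :=
  lt_idx_iff.2 ⟨α, h, le_rfl⟩

theorem idx_le_idx {α β : RelSet} (h : α.typ ≤ β.typ) : α.idx ≤ β.idx :=
  le_of_forall_lt fun _ ho => by
    obtain ⟨γ, hγ, hγ'⟩ := lt_idx_iff.1 ho
    exact lt_idx_iff.2 ⟨γ, hγ.trans_le h, hγ'⟩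

theorem idx_eq_idx {α β : RelSet} (h : α.typ = β.typ) : α.idx = β.idx :=
  (idx_le_idx h.le).antisymm (idx_le_idx h.ge)

theorem idx_eq_zero {α : RelSet} (h : α.carrier = ∅) : α.idx = 0 := by
  by_contra h0
  obtain ⟨β, hβ, -⟩ := lt_idx_iff.1 (pos_iff_ne_zero.2 h0)
  rw [typ_eq_zero h] at hβ
  exact not_lt_zero hβ

theorem mem_diff_single_iff {A m : ASet} (hm : m ∉ diff A (single m)) {x : ASet} :
    x ∈ diff A (single m) ↔ x ∈ A ∧ x ≠ m := by
  constructor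
  · intro hx
    exact ⟨diff_subset hx, fun h => hm (h ▸ hx)⟩
  · rintro ⟨hx, hne⟩
    exact mem_diff.2 (subset_closure ⟨hx, fun h => hne (mem_single.1 h)⟩)

theorem IsMax.mem_diff_iff_less {α : RelSet} {m : ASet}
    (hm : IsMax α.rel α.carrier m) (hmd : m ∉ diff α.carrier (single m)) (x : ASet) :
    x ∈ diff α.carrier (single m) ↔ x ∈ α.carrier ∧ Less α.rel x m := by
  rw [mem_diff_single_iff hmd]
  exact ⟨fun hx => ⟨hx.1, hm.2 x hx.1 hx.2⟩, fun hx => ⟨hx.1, hx.2.1⟩⟩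

theorem IsPredecessor.exists_typ_eq {p α : RelSet} (h : IsPredecessor p α) (hα : IsOrdinal α) :
    ∃ m, IsMax α.rel α.carrier m ∧ p.typ = α.pos m := by
  obtain ⟨hp, m, hm, hmd, heq⟩ := h
  refine ⟨m, hm, ?_⟩
  rw [← heq.typ_eq (hα.restrict fun x hx => diff_subset hx) hp]
  exact hα.typ_restrict hm.1 (hm.mem_diff_iff_less hmd)

theorem IsPredecessor.idx_eq {p α : RelSet} (h : IsPredecessor p α) (hα : IsOrdinal α) :
    α.idx = p.idx + 1 := by
  obtain ⟨m, hm, hpm⟩ := h.exists_typ_eq hα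
  refine le_antisymm (le_of_forall_lt fun o ho => ?_) (Order.add_one_le_of_lt ?_)
  · obtain ⟨γ, hγ, hoγ⟩ := lt_idx_iff.1 ho
    refine Order.lt_add_one_iff.2 (hoγ.trans (idx_le_idx ?_))
    obtain ⟨x, hx, hxγ⟩ := hα.exists_pos_eq hγ
    rw [hpm, ← hxγ]
    by_cases hxm : x = m
    · rw [hxm]
    · exact ((hα.pos_lt_pos hx hm.1).2 (hm.2 x hx hxm)).le
  · exact idx_lt_idx (hpm ▸ hα.pos_lt_typ hm.1)

/-- If the part of `α` below its maximum `b` had the type of an ordinal `β`, it would be empty or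
have a last element, corresponding to `max β`. It would then be closed, so `b` could really be
removed and `α` would have a predecessor. -/
theorem IsLimitOrdinal.not_isMax_of_pos_eq {α β : RelSet} (hα : IsLimitOrdinal α)
    (hβ : IsOrdinal β) {b : ASet} (hb : IsMax α.rel α.carrier b) : α.pos b ≠ β.typ := by
  intro heq
  obtain ⟨h, -, hnp⟩ := hα
  have hcl : IsClosed {x ∈ α.carrier.pts | Less α.rel x b} := by
    by_cases hβe : β.carrier = ∅
    · rw [typ_eq_zero hβe] at heq
      convert isClosed_empty
      refine eq_empty_of_forall_notMem fun x hx => ?_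
      have := (h.pos_lt_pos hx.1 hb.1).2 hx.2
      rw [heq] at this
      exact not_lt_zero this
    · obtain ⟨c, hc⟩ := hβ.exists_max hβe
      have hlt : β.pos c < α.pos b := heq ▸ hβ.pos_lt_typ hc.1
      obtain ⟨d, hd, hdc⟩ := h.exists_pos_eq (hlt.trans (h.pos_lt_typ hb.1))
      convert isClosed_setOf_le α d using 1
      ext x
      constructor
      · rintro ⟨hx, hxb⟩
        refine ⟨hx, ?_⟩
        by_contra! hn
        have hdx := (h.total x hx d hd hn.1).resolve_left hn.2
        rw [← h.pos_lt_pos hd hx, hdc] at hdx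
        rw [← h.pos_lt_pos hx hb.1, heq] at hxb
        obtain ⟨y, hy, hyx⟩ := hβ.exists_pos_eq hxb
        rw [← hyx, hβ.pos_lt_pos hc.1 hy] at hdx
        exact hβ.asymm c hc.1 y hy hdx (hc.2 y hy hdx.1.symm)
      · rintro ⟨hx, rfl | hxd⟩
        · exact ⟨hx, (h.pos_lt_pos hx hb.1).1 (hdc ▸ hlt)⟩
        · refine ⟨hx, (h.pos_lt_pos hx hb.1).1 ?_⟩
          exact ((h.pos_lt_pos hx hd).2 hxd).trans (hdc ▸ hlt)
  refine hnp ⟨α.restrict (diff α.carrier (single b)), h.restrict fun x hx => diff_subset hx, b, hb,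
    fun hbd => ?_, ordEq_refl _⟩
  have := closure_minimal (fun x (hx : x ∈ α.carrier.pts \ (single b).pts) =>
    (⟨hx.1, hb.2 x hx.1 fun h => hx.2 (mem_single.2 h)⟩ :
      x ∈ {x ∈ α.carrier.pts | Less α.rel x b})) hcl (mem_diff.1 hbd)
  exact less_irrefl _ _ this.2

/-- The index of a limit is the supremum of the indices below it. A type `γ` below `α` is the
position of some `b`, which is not the maximum. The segment up to and including `b` is closed,
proper and longer than `γ`. -/
theorem IsLimitOrdinal.exists_ordLT {α : RelSet} (hα : IsLimitOrdinal α) {o : Ordinal.{0}}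
    (ho : o < α.idx) : ∃ β, IsOrdinal β ∧ OrdLT β α ∧ o < β.idx := by
  have h := hα.1
  obtain ⟨γ', hγ', hoγ'⟩ := lt_idx_iff.1 ho
  obtain ⟨γ, hγ, hγγ'⟩ := exists_isOrdinal_typ_eq γ'
  rw [← hγγ'] at hγ'
  rw [← idx_eq_idx hγγ'] at hoγ'
  obtain ⟨b, hb, hbγ⟩ := h.exists_pos_eq hγ'
  have hcl := isClosed_setOf_le α b
  set S := hull fun x => x ∈ α.carrier ∧ (x = b ∨ Less α.rel x b)
  have hS : ∀ x, x ∈ S ↔ x ∈ α.carrier ∧ (x = b ∨ Less α.rel x b) :=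
    fun x => mem_hull_of_isClosed hcl
  have hini : IsInitialSegment S α := by
    refine ⟨fun x hx => ((hS x).1 hx).1, fun x hx y hy hl => (hS y).2 ⟨hy, Or.inr ?_⟩⟩
    obtain ⟨hx, rfl | hxb⟩ := (hS x).1 hx
    · exact hl
    · exact h.trans y hy x hx b hb hl hxb
  have hord := h.restrict hini.1
  refine ⟨α.restrict S, hord, ordLT_restrict hini fun hSα => ?_, hoγ'.trans_lt (idx_lt_idx ?_)⟩
  · refine hα.not_isMax_of_pos_eq hγ ⟨hb, fun x hx hxb => ?_⟩ hbγ
    rw [← hSα] at hx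
    exact ((hS x).1 hx).2.resolve_left hxb
  · have hbS : b ∈ (α.restrict S).carrier := (hS b).2 ⟨hb, Or.inl rfl⟩
    have hpos := (initialMap_restrict hini).pos_eq hord h hbS
    rw [id] at hpos
    rw [← hbγ, hpos]
    exact hord.pos_lt_typ hbS

/-- The iterated derived set `A^(α)`. -/
noncomputable def iterDerived (A : ASet) (α : RelSet) : ASet := hull (· ∈ cbDeriv A.pts α.idx)

theorem pts_iterDerived (A : ASet) (α : RelSet) :
    (iterDerived A α).pts = cbDeriv A.pts α.idx :=
  (pts_hull _).trans (isClosed_cbDeriv (isClosed_pts A) _).closure_eq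

theorem iterDerived_zero (A : ASet) {α : RelSet} (h : α.carrier = ∅) : iterDerived A α = A :=
  pts_injective (by rw [pts_iterDerived, idx_eq_zero h, cbDeriv_zero])

theorem iterDerived_succ (A : ASet) {p α : RelSet} (hα : IsOrdinal α) (hp : IsPredecessor p α) :
    derived (iterDerived A p) = iterDerived A α :=
  pts_injective (by rw [pts_derived, pts_iterDerived, pts_iterDerived, hp.idx_eq hα,
    cbDeriv_add_one (isClosed_pts A)])

theorem iterDerived_limit (A : ASet) {α : RelSet} (hα : IsLimitOrdinal α) :
    (hull fun x => ∀ β, IsOrdinal β → OrdLT β α → x ∈ iterDerived A β) = iterDerived A α := by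
  refine congrArg hull (funext fun x => propext ?_)
  have hmem : ∀ β, x ∈ iterDerived A β ↔ x ∈ cbDeriv A.pts β.idx := fun β => by
    rw [← pts_iterDerived, mem_pts]
  simp only [hmem]
  constructor
  · intro h
    refine mem_cbDeriv.2 ⟨?_, fun γ hγ => ?_⟩
    · have h0 : (0 : Ordinal.{0}) < α.idx := by
        obtain ⟨b, hb⟩ := ne_empty_iff.1 hα.2.1
        exact lt_idx_iff.2 ⟨⟨∅, ∅⟩, by
          rw [typ_eq_zero rfl]
          exact zero_le.trans_lt (hα.1.pos_lt_typ hb), zero_le⟩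
      obtain ⟨β, hβ, hlt, -⟩ := hα.exists_ordLT h0
      exact cbDeriv_subset _ _ (h β hβ hlt)
    · obtain ⟨β, hβ, hlt, hγβ⟩ := hα.exists_ordLT hγ
      exact cbDeriv_subset_derivedSet _ hγβ (h β hβ hlt)
  · intro h β hβ hlt
    exact cbDeriv_antitone _ (idx_lt_idx (hlt.typ_lt hβ hα.1)).le h

theorem IsIterDerived.eq_iterDerived {A D : ASet} {α : RelSet} (h : IsIterDerived A α D) :
    D = iterDerived A α := by
  induction h with
  | zero α _ h => exact (iterDerived_zero A h).symm
  | succ α p D hα hp _ ih => rw [ih, iterDerived_succ A hα hp]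
  | limit α D hα _ ih =>
    rw [← iterDerived_limit A hα]
    refine congrArg hull (funext fun x => propext ?_)
    exact forall_congr' fun β => forall_congr' fun hβ => forall_congr' fun hlt => by
      rw [ih β hβ hlt]

theorem isIterDerived_iterDerived (A : ASet) {α : RelSet} (hα : IsOrdinal α) :
    IsIterDerived A α (iterDerived A α) := by
  induction α using (InvImage.wf RelSet.typ wellFounded_lt).induction with
  | _ α ih =>
    by_cases h0 : α.carrier = ∅
    · rw [iterDerived_zero A h0]
      exact .zero α hα h0
    by_cases hp : ∃ p, IsPredecessor p α
    · obtain ⟨p, hp⟩ := hp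
      obtain ⟨m, hm, hpm⟩ := hp.exists_typ_eq hα
      rw [← iterDerived_succ A hα hp]
      exact .succ α p _ hα hp (ih p (hpm ▸ hα.pos_lt_typ hm.1 : p.typ < α.typ) hp.1)
    · have hl : IsLimitOrdinal α := ⟨hα, h0, hp⟩
      rw [← iterDerived_limit A hl]
      exact .limit α (iterDerived A) hl fun β hβ hlt => ih β (hlt.typ_lt hβ hα) hβ

theorem derivedVanishesAfter_iff {A : ASet} {α : RelSet} (hα : IsOrdinal α) :
    DerivedVanishesAfter A α ↔ derivedSet (cbDeriv A.pts α.idx) = ∅ := by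
  have : derived (iterDerived A α) = ∅ ↔ derivedSet (cbDeriv A.pts α.idx) = ∅ := by
    rw [eq_empty_iff, pts_derived, pts_iterDerived]
  rw [← this]
  constructor
  · rintro ⟨D, hD, h⟩
    rwa [← hD.eq_iterDerived]
  · exact fun h => ⟨_, isIterDerived_iterDerived A hα, h⟩

theorem IsCBRank.derivedSet_eq_empty {A : ASet} {ρ : RelSet} (h : IsCBRank A ρ) :
    derivedSet (cbDeriv A.pts ρ.idx) = ∅ :=
  (derivedVanishesAfter_iff h.isOrdinal).1 h.vanishes

/-- If the derived set were already empty at a smaller index, it would vanish after some ordinal of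
smaller type than `ρ`, against minimality. -/
theorem IsCBRank.cbDeriv_nonempty {A : ASet} {ρ : RelSet} (h : IsCBRank A ρ) (hne : A ≠ ∅) :
    (cbDeriv A.pts ρ.idx).Nonempty := by
  refine _root_.cbDeriv_nonempty (isClosed_pts A) (ne_empty_iff.1 hne) fun o ho => ?_
  obtain ⟨γ', hγ', hoγ'⟩ := lt_idx_iff.1 ho
  obtain ⟨γ, hγ, hγγ'⟩ := exists_isOrdinal_typ_eq γ'
  rw [← hγγ'] at hγ'
  rw [← idx_eq_idx hγγ'] at hoγ'
  rw [nonempty_iff_ne_empty]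
  intro hemp
  have hv : DerivedVanishesAfter A γ := (derivedVanishesAfter_iff hγ).2
    (subset_empty_iff.1 (hemp ▸ derivedSet_mono _ _ (cbDeriv_antitone _ hoγ')))
  exact ((h.least γ hγ hv).typ_le h.isOrdinal hγ).not_gt hγ'

end AS

theorem theorem10p13 :
    (∀ A : AS.ASet, AS.WellOrderable A → A ≠ ∅ →
      ∀ n : ℕ, AS.CardLT (AS.prod (AS.nOrd n) A) (AS.prod (AS.nOrd (n + 1)) A)) ∧
    (∀ A₁ A₂ : AS.ASet, AS.IsInfinite A₁ → AS.IsInfinite A₂ →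
      AS.WellOrderable A₁ → AS.WellOrderable A₂ →
      AS.CardLT (AS.sum A₁ A₂) (AS.prod A₁ A₂)) ∧
    (∀ A₁ A₂ : AS.ASet, AS.WellOrderable A₁ → AS.WellOrderable A₂ → AS.CardLE A₁ A₂ →
      ∀ ρ₁ ρ₂ : AS.RelSet, AS.IsCBRank A₁ ρ₁ → AS.IsCBRank A₂ ρ₂ →
        (AS.OrdLT ρ₁ ρ₂ → AS.CardEq (AS.sum A₁ A₂) A₂) ∧
        (A₁ ≠ ∅ → AS.OrdEq ρ₁ ρ₂ → AS.CardLT A₂ (AS.sum A₁ A₂))) := by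
  refine ⟨fun A hA hne n => hA.prod_nOrd_cardLT hne n, fun A₁ A₂ h₁ h₂ hw₁ hw₂ =>
    AS.cardLT_of_not_cardLE (AS.sum_cardLE_prod h₁ h₂) (AS.not_prod_cardLE_sum h₁ h₂ hw₁ hw₂),
    fun A₁ A₂ _ _ hle ρ₁ ρ₂ hρ₁ hρ₂ => ⟨fun hlt => ⟨?_, AS.cardLE_sum_right A₁ A₂⟩,
      fun hne heq => AS.cardLT_of_not_cardLE (AS.cardLE_sum_right A₁ A₂) ?_⟩⟩
  · have hidx := AS.idx_lt_idx (hlt.typ_lt hρ₁.isOrdinal hρ₂.isOrdinal)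
    -- Absorption needs a point in the last derivative of `A₂`; if `A₂` is empty, then `A₁ ≤_c A₂`
    -- makes `A₁` empty as well.
    by_cases hne : A₂ = ∅
    · have hemp : A₁ = ∅ := by
        obtain ⟨f, hf⟩ := hle
        by_contra h
        obtain ⟨a, ha⟩ := AS.ne_empty_iff.1 h
        obtain ⟨b, hb, -⟩ := hf.total a ha
        exact AS.not_mem_empty b (hne ▸ hb)
      refine AS.sum_cardLE (f := id) (g := id) ?_ ?_ ?_
      · rw [AS.eq_empty_iff.1 hemp]
        exact AS.embeds_empty _ _
      · rw [AS.eq_empty_iff.1 hne]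
        exact AS.embeds_empty _ _
      · exact fun x hx => absurd (hemp ▸ hx) (AS.not_mem_empty x)
    · refine AS.sum_cardLE_right ?_ (hρ₂.cbDeriv_nonempty hne) hρ₂.derivedSet_eq_empty
      exact subset_empty_iff.1 (hρ₁.derivedSet_eq_empty ▸ cbDeriv_subset_derivedSet _ hidx)
  · have hidx := AS.idx_eq_idx (heq.typ_eq hρ₁.isOrdinal hρ₂.isOrdinal)
    refine AS.not_sum_cardLE_right (hρ₁.cbDeriv_nonempty hne) hρ₁.derivedSet_eq_empty ?_
    rw [hidx]
    exact hρ₂.derivedSet_eq_empty
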